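/- Let $c,d\ge 0$ be integers. A component $\alpha=(\Gamma,\beta)$ of the Gaussian copula model for $c$ continuous and $d$ integer variables consists of means $\mu_j\in\mathbb{R}$ and standard deviations $\sigma_j>0$ ($1\le j\le c$), Poisson parameters $\beta_j>0$ ($c+1\le j\le c+d$), and a positive definite correlation matrix $\Gamma=\begin{pmatrix}\Gamma_{CC}&\Gamma_{CD}\\ \Gamma_{DC}&\Gamma_{DD}\end{pmatrix}$ of size $c+d$, partitioned according to continuous (C) and integer (D) variables. Its margins are the Gaussian distributions $\mathcal N(\mu_j,\sigma_j^2)$ and the Poisson distributions with parameters $\beta_j$, and its pdf/pmf at $x=(x^C,x^D)\in\mathbb{R}^c\times\mathbb{N}^d$ is $$p(x\mid\alpha)=\frac{\phi_c(y^C\mid 0,\Gamma_{CC})}{\prod_{j=1}^c\sigma_j}\int_{S(x^D)}\phi_d(u\mid \mu^D,\Sigma^D)\,du,$$ where $\phi_n(\cdot\mid m,S)$ is the density of the $n$-variate Gaussian distribution with mean $m$ and covariance matrix $S$ (with the usual convention that factors of dimension $0$ equal $1$), $y^C=\big((x^j-\mu_j)/\sigma_j\big)_{1\le j\le c}$, $\mu^D=\Gamma_{DC}\Gamma_{CC}^{-1}y^C$,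 $\Sigma^D=\Gamma_{DD}-\Gamma_{DC}\Gamma_{CC}^{-1}\Gamma_{CD}$, and $S(x^D)=\prod_{j=c+1}^{c+d}\big(\Phi_1^{-1}(P(x^j-1\mid\beta_j)),\,\Phi_1^{-1}(P(x^j\mid\beta_j))\big]$ (each interval being intersected with $\mathbb{R}$), with $P(\cdot\mid\beta_j)$ the cdf of the Poisson distribution with parameter $\beta_j$ and $\Phi_1^{-1}$ the inverse of the standard Gaussian cdf ($\Phi_1^{-1}(0)=-\infty$). The Gaussian copula mixture model with Gaussian and Poisson margins is weakly identifiable, i.e. identifiable up to a relabelling of the components: let $\alpha_1,\dots,\alpha_g$ be pairwise distinct components with proportions $\pi_1,\dots,\pi_g>0$, $\sum_k\pi_k=1$, and let $\alpha'_1,\dots,\alpha'_{g'}$ be pairwise distinct components with proportions $\pi'_1,\dots,\pi'_{g'}>0$, $\sum_k\pi'_k=1$. If $$\sum_{k=1}^g\pi_k\,p(x\mid\alpha_k)=\sum_{k=1}^{g'}\pi'_k\,p(x\mid\alpha'_k)\qquad\text{for all }x\in\mathbb{R}^c\times\mathbb{N}^d,$$ then $g=g'$ and there is a permutation $\tau$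 of $\{1,\dots,g\}$ such that, for every $k$, $\pi'_{\tau(k)}=\pi_k$ and $\alpha'_{\tau(k)}=\alpha_k$; that is, the means, the standard deviations, the Poisson parameters and the full correlation matrices agree. -/

import Mathlib

open MeasureTheory ProbabilityTheory
open scoped NNReal

namespace CopulaMixture

/-- The density at `y` of the `n`-variate Gaussian distribution with mean `m` and (positive
definite) covariance matrix `S`. -/
noncomputable def gaussianDensity {n : ℕ} (m : Fin n → ℝ) (S : Matrix (Fin n) (Fin n) ℝ)
    (y : Fin n → ℝ) : ℝ :=
  (Real.sqrt ((2 * Real.pi) ^ n * S.det))⁻¹ *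
    Real.exp (-((y - m) ⬝ᵥ S⁻¹.mulVec (y - m)) / 2)

/-- The cumulative distribution function `Φ₁` of the standard Gaussian distribution. -/
noncomputable def stdGaussianCDF (y : ℝ) : ℝ := cdf (gaussianReal 0 1) y

/-- The inverse `Φ₁⁻¹` of `Φ₁`, with values in the extended real line: it is `-∞` at `0`, `+∞` at
`1`, and the unique real `y` with `Φ₁ y = u` when `0 < u < 1`. -/
noncomputable def stdGaussianQuantile (u : ℝ) : EReal :=
  sInf {y : EReal | ∃ r : ℝ, y = (r : EReal) ∧ u ≤ stdGaussianCDF r}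

/-- The cumulative distribution function at `t` of the Poisson distribution with parameter `b`. -/
noncomputable def poissonCDF (b : ℝ≥0) (t : ℝ) : ℝ :=
  (poissonMeasure b).real {n : ℕ | (n : ℝ) ≤ t}

/-- The parameters of one component for `c` continuous and `d` integer variables: the mean and the
standard deviation of each Gaussian margin, the parameter of each Poisson margin, and the
(positive definite) correlation matrix of the Gaussian copula. -/
@[ext]
structure Component (c d : ℕ) where
  mean : Fin c → ℝ
  sd : Fin c → ℝ
  sd_pos : ∀ j, 0 < sd j
  rate : Fin d → ℝ≥0
  rate_pos : ∀ j, 0 < rate j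
  corr : Matrix (Fin c ⊕ Fin d) (Fin c ⊕ Fin d) ℝ
  corr_posDef : corr.PosDef
  corr_diag : ∀ i, corr i i = 1

namespace Component

variable {c d : ℕ} (a : Component c d)

/-- The values of the continuous variables after standardization, which are the latent Gaussian
coordinates that they determine. -/
noncomputable def latent (x : Fin c → ℝ) : Fin c → ℝ := fun j => (x j - a.mean j) / a.sd j

/-- The mean of the latent Gaussian coordinates of the integer variables, conditionally on the
continuous variables. -/
noncomputable def condMean (x : Fin c → ℝ) : Fin d → ℝ :=
  (a.corr.toBlocks₂₁ * a.corr.toBlocks₁₁⁻¹).mulVec (a.latent x)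

/-- The covariance matrix of the latent Gaussian coordinates of the integer variables,
conditionally on the continuous variables. -/
noncomputable def condCov : Matrix (Fin d) (Fin d) ℝ :=
  a.corr.toBlocks₂₂ - a.corr.toBlocks₂₁ * a.corr.toBlocks₁₁⁻¹ * a.corr.toBlocks₁₂

/-- The interval `(Φ₁⁻¹(P(n - 1)), Φ₁⁻¹(P(n))]`, where `P` is the Poisson cumulative distribution
function of the `j`-th integer variable: the latent values that produce the observation `n`. -/
noncomputable def latentInterval (j : Fin d) (n : ℕ) : Set ℝ :=
  {y : ℝ | stdGaussianQuantile (poissonCDF (a.rate j) ((n : ℝ) - 1)) < (y : EReal) ∧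
    (y : EReal) ≤ stdGaussianQuantile (poissonCDF (a.rate j) (n : ℝ))}

/-- The pdf/pmf of the component at `(x, n)`, with `x` the continuous and `n` the integer
variables. -/
noncomputable def density (x : Fin c → ℝ) (n : Fin d → ℕ) : ℝ :=
  gaussianDensity 0 a.corr.toBlocks₁₁ (a.latent x) / (∏ j, a.sd j) *
    ∫ u in {u : Fin d → ℝ | ∀ j, u j ∈ a.latentInterval j (n j)},
      gaussianDensity (a.condMean x) a.condCov u

end Component

end CopulaMixture

/-! It suffices that the densities of distinct components are linearly independent
(`linearIndependent_density`); the proportions and parameters are then read off from the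
coefficients. Independence is obtained by comparing growth along a sequence of observations.

A Poisson count `n` corresponds to a latent Gaussian value of size `√(2 n log n)`. Hence for
positive integers `v i`, continuous values `speed m * v j` and counts `v j ^ 2 * m + 1` make all
latent coordinates grow like `speed m * v`, whatever the component. The density is a constant times
the integral of an unnormalized Gaussian over a small box, so its logarithm is `-energy + o(speed
m)`, where `energy` is half the quadratic form of `cov⁻¹` at a corner of the box.

For two distinct components the energies differ by more than this error, at one of three scales
(`exists_polynomial_energy`). Different covariances give order `speed ^ 2`; equal covariances but
different Poisson rates give order `m`, since changing the rate shifts the latent value by order `m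
/ speed m`; if only the means differ, the order is `speed`. Each time the leading coefficient is a
nonzero polynomial in `v`. A single `v` avoids the zeros of all these polynomials, so the ratio of
any two densities tends to `0` or to infinity. In a vanishing linear combination the dominant
density must then have coefficient zero. -/

namespace CopulaMixture

/-! ### The standard Gaussian distribution function and its tails -/

lemma stdGaussianCDF_sub {a b : ℝ} (h : a ≤ b) :
    stdGaussianCDF b - stdGaussianCDF a = ∫ x in Set.Ioc a b, gaussianPDFReal 0 1 x := by
  have h1 : (gaussianReal 0 1).real (Set.Iic b) - (gaussianReal 0 1).real (Set.Iic a)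
      = (gaussianReal 0 1).real (Set.Ioc a b) := by
    rw [← measureReal_sdiff (Set.Iic_subset_Iic.2 h) measurableSet_Iic]
    congr 1
    ext x
    simp [and_comm]
  rw [stdGaussianCDF, stdGaussianCDF, cdf_eq_real, cdf_eq_real, h1, measureReal_def,
    gaussianReal_apply_eq_integral _ one_ne_zero, ENNReal.toReal_ofReal]
  exact integral_nonneg fun x => gaussianPDFReal_nonneg _ _ _

lemma gaussianPDFReal_std (x : ℝ) :
    gaussianPDFReal 0 1 x = (Real.sqrt (2 * Real.pi))⁻¹ * Real.exp (-x ^ 2 / 2) := by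
  simp [gaussianPDFReal]

lemma gaussianPDFReal_std_anti {x y : ℝ} (hx : 0 ≤ x) (h : x ≤ y) :
    gaussianPDFReal 0 1 y ≤ gaussianPDFReal 0 1 x := by
  rw [gaussianPDFReal_std, gaussianPDFReal_std]
  gcongr

lemma one_le_sqrt_two_pi : 1 ≤ Real.sqrt (2 * Real.pi) :=
  Real.one_le_sqrt.2 (by nlinarith [Real.pi_gt_three])

lemma sqrt_two_pi_le_exp_one : Real.sqrt (2 * Real.pi) ≤ Real.exp 1 := by
  rw [Real.sqrt_le_left (Real.exp_pos 1).le]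
  nlinarith [Real.pi_lt_d2, Real.exp_one_gt_d9]

lemma gaussianPDFReal_std_le_exp (x : ℝ) :
    gaussianPDFReal 0 1 x ≤ Real.exp (-x ^ 2 / 2) := by
  rw [gaussianPDFReal_std]
  exact mul_le_of_le_one_left (Real.exp_pos _).le (inv_le_one_of_one_le₀ one_le_sqrt_two_pi)

/-- Trading the factor `1 / √(2π)` for `exp (-1)` keeps the bound a pure exponential, so that tails
can be compared through their exponents. -/
lemma exp_le_gaussianPDFReal_std (x : ℝ) :
    Real.exp (-x ^ 2 / 2 - 1) ≤ gaussianPDFReal 0 1 x := by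
  rw [gaussianPDFReal_std, Real.exp_sub, div_eq_inv_mul]
  have := sqrt_two_pi_le_exp_one
  have := one_le_sqrt_two_pi
  gcongr

lemma stdGaussianCDF_sub_le {a b C : ℝ} (h : a ≤ b)
    (hC : ∀ x, a ≤ x → gaussianPDFReal 0 1 x ≤ C) :
    stdGaussianCDF b - stdGaussianCDF a ≤ C * (b - a) := by
  rw [stdGaussianCDF_sub h]
  calc ∫ x in Set.Ioc a b, gaussianPDFReal 0 1 x ≤ ∫ x in Set.Ioc a b, C := by
        refine setIntegral_mono_on (integrable_gaussianPDFReal 0 1).integrableOn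
          (by simp) measurableSet_Ioc fun x hx => hC x hx.1.le
    _ = C * (b - a) := by simp [h, mul_comm]

lemma le_stdGaussianCDF_sub {a b C : ℝ} (h : a ≤ b)
    (hC : ∀ x, a < x → x ≤ b → C ≤ gaussianPDFReal 0 1 x) :
    C * (b - a) ≤ stdGaussianCDF b - stdGaussianCDF a := by
  rw [stdGaussianCDF_sub h]
  calc C * (b - a) = ∫ x in Set.Ioc a b, C := by simp [h, mul_comm]
    _ ≤ ∫ x in Set.Ioc a b, gaussianPDFReal 0 1 x := by
        refine setIntegral_mono_on (by simp) (integrable_gaussianPDFReal 0 1).integrableOn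
          measurableSet_Ioc fun x hx => hC x hx.1 hx.2

lemma stdGaussianCDF_strictMono : StrictMono stdGaussianCDF := by
  intro a b h
  have := le_stdGaussianCDF_sub (C := Real.exp (-(max |a| |b|) ^ 2 / 2 - 1)) h.le
    (fun x hx hx' => (Real.exp_le_exp.2 ?_).trans (exp_le_gaussianPDFReal_std x))
  · have := mul_pos (Real.exp_pos (-(max |a| |b|) ^ 2 / 2 - 1)) (sub_pos.2 h)
    linarith
  · have : |x| ≤ max |a| |b| := abs_le_max_abs_abs hx.le hx'
    have := sq_le_sq' (by linarith [abs_nonneg x, neg_abs_le x]) (le_of_abs_le this)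
    linarith

lemma stdGaussianCDF_continuous : Continuous stdGaussianCDF := by
  refine LipschitzWith.continuous (K := 1) (LipschitzWith.of_le_add_mul 1 fun x y => ?_)
  have h1 : ∀ x, gaussianPDFReal 0 1 x ≤ 1 := fun x =>
    (gaussianPDFReal_std_le_exp x).trans (Real.exp_le_one_iff.2 (by nlinarith [sq_nonneg x]))
  rcases le_total x y with h | h
  · have := stdGaussianCDF_strictMono.monotone h
    have : 0 ≤ dist x y := dist_nonneg
    simp
    linarith
  · have := stdGaussianCDF_sub_le h fun x _ => h1 x
    rw [Real.dist_eq, abs_of_nonneg (sub_nonneg.2 h)]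
    simp
    linarith

lemma exists_stdGaussianCDF_eq {u : ℝ} (h0 : 0 < u) (h1 : u < 1) :
    ∃ r : ℝ, stdGaussianCDF r = u := by
  refine mem_range_of_exists_le_of_exists_ge stdGaussianCDF_continuous ?_ ?_
  · exact ((tendsto_cdf_atBot (gaussianReal 0 1)).eventually (ge_mem_nhds h0)).exists
  · exact ((tendsto_cdf_atTop (gaussianReal 0 1)).eventually (le_mem_nhds h1)).exists

lemma stdGaussianQuantile_stdGaussianCDF (r : ℝ) :
    stdGaussianQuantile (stdGaussianCDF r) = r := by
  refine le_antisymm (sInf_le ⟨r, rfl, le_rfl⟩) (le_sInf ?_)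
  rintro _ ⟨t, rfl, ht⟩
  exact EReal.coe_le_coe_iff.2 (stdGaussianCDF_strictMono.le_iff_le.1 ht)

/-- Chernoff bound with the optimal parameter `q`. -/
lemma one_sub_stdGaussianCDF_le {q : ℝ} (hq : 0 ≤ q) :
    1 - stdGaussianCDF q ≤ Real.exp (-q ^ 2 / 2) := by
  have h := measure_ge_le_exp_mul_mgf (μ := gaussianReal 0 1) (X := id) q hq
    (integrable_exp_mul_gaussianReal q)
  rw [mgf_id_gaussianReal, ← Real.exp_add] at h
  have h2 : 1 - stdGaussianCDF q ≤ (gaussianReal 0 1).real {ω | q ≤ id ω} := by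
    rw [stdGaussianCDF, cdf_eq_real, ← probReal_compl_eq_one_sub measurableSet_Iic]
    refine measureReal_mono fun x hx => ?_
    simp at hx ⊢
    exact hx.le
  refine (h2.trans h).trans (Real.exp_le_exp.2 ?_)
  simp
  nlinarith

/-- The tail contains the mass of `(q, q + 1 / q]`, where `x ^ 2 / 2` exceeds `q ^ 2 / 2` by at most
`3 / 2`; the normalization costs `1` more. -/
lemma le_one_sub_stdGaussianCDF {q : ℝ} (hq : 1 ≤ q) :
    Real.exp (-q ^ 2 / 2 - 3) / q ≤ 1 - stdGaussianCDF q := by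
  have hq0 : 0 < q := by linarith
  have hi : 0 < 1 / q := by positivity
  have h := le_stdGaussianCDF_sub (a := q) (b := q + 1 / q) (C := Real.exp (-q ^ 2 / 2 - 3))
    (by linarith) (fun x hx hx' => ?_)
  · have h1 : stdGaussianCDF (q + 1 / q) ≤ 1 := cdf_le_one _ _
    rw [add_sub_cancel_left, mul_one_div] at h
    linarith
  · refine le_trans (Real.exp_le_exp.2 ?_) (exp_le_gaussianPDFReal_std x)
    have h1 : 1 / q ≤ 1 := by rw [div_le_one hq0]; exact hq
    have h2 : x ^ 2 ≤ (q + 1 / q) ^ 2 := pow_le_pow_left₀ (by linarith) hx' 2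
    have h3 : (q + 1 / q) ^ 2 = q ^ 2 + 2 + (1 / q) ^ 2 := by field_simp; ring
    nlinarith

/-! ### The Poisson distribution function and its tail -/

lemma poissonCDF_natCast (b : ℝ≥0) (n : ℕ) :
    poissonCDF b n = (poissonMeasure b).real (Set.Iic n) := by
  simp [poissonCDF, Set.Iic]

lemma poissonCDF_natCast_succ_sub_one (b : ℝ≥0) (n : ℕ) :
    poissonCDF b (((n + 1 : ℕ) : ℝ) - 1) = poissonCDF b n := by
  congr 1
  push_cast
  ring

lemma poissonCDF_succ_sub (b : ℝ≥0) (n : ℕ) :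
    poissonCDF b (n + 1 : ℕ) - poissonCDF b n
      = Real.exp (-b) * b ^ (n + 1) / (n + 1).factorial := by
  rw [poissonCDF_natCast, poissonCDF_natCast, ← poissonMeasure_real_singleton,
    ← measureReal_sdiff (Set.Iic_subset_Iic.2 n.le_succ) measurableSet_Iic]
  congr 1
  ext k
  simp
  omega

lemma le_one_sub_poissonCDF (b : ℝ≥0) (n : ℕ) :
    Real.exp (-b) * b ^ (n + 1) / (n + 1).factorial ≤ 1 - poissonCDF b n := by
  rw [← poissonCDF_succ_sub, poissonCDF_natCast b (n + 1)]
  gcongr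
  exact measureReal_le_one

/-- Since `(n + 1)! * k! ≤ (n + 1 + k)!`, the tail is dominated termwise by `b ^ (n + 1) / (n + 1)!`
times a whole Poisson distribution. -/
lemma one_sub_poissonCDF_le (b : ℝ≥0) (n : ℕ) :
    1 - poissonCDF b n ≤ b ^ (n + 1) / (n + 1).factorial := by
  have hs := hasSum_one_poissonMeasure b
  have h1 : poissonCDF b n
      = ∑ k ∈ Finset.range (n + 1), Real.exp (-b) * (b : ℝ) ^ k / k.factorial := by
    rw [poissonCDF_natCast]
    simp_rw [← poissonMeasure_real_singleton]
    rw [sum_measureReal_singleton]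
    congr 1
    ext k
    simp
  have h2 := hs.summable.sum_add_tsum_nat_add (n + 1)
  rw [hs.tsum_eq] at h2
  rw [h1, ← h2, add_sub_cancel_left]
  have h3 : HasSum (fun k => (b : ℝ) ^ (n + 1) / (n + 1).factorial *
      (Real.exp (-b) * (b : ℝ) ^ k / k.factorial)) ((b : ℝ) ^ (n + 1) / (n + 1).factorial) := by
    simpa using hs.mul_left ((b : ℝ) ^ (n + 1) / (n + 1).factorial)
  refine (((summable_nat_add_iff (n + 1)).2 hs.summable).tsum_le_tsum (fun k => ?_)
    h3.summable).trans_eq h3.tsum_eq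
  have h4 : (((n + 1).factorial : ℝ) * k.factorial) ≤ ((k + (n + 1)).factorial : ℝ) := by
    rw [add_comm k]
    exact_mod_cast Nat.le_of_dvd (Nat.factorial_pos _) (Nat.factorial_mul_factorial_dvd_factorial_add _ _)
  calc Real.exp (-b) * (b : ℝ) ^ (k + (n + 1)) / (k + (n + 1)).factorial
      ≤ Real.exp (-b) * (b : ℝ) ^ (k + (n + 1)) / (((n + 1).factorial : ℝ) * k.factorial) := by
        gcongr
    _ = _ := by rw [pow_add]; field_simp

lemma poissonCDF_pos {b : ℝ≥0} (hb : 0 < b) (n : ℕ) : 0 < poissonCDF b n := by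
  rw [poissonCDF_natCast]
  exact (poissonMeasure_real_singleton_pos n hb).trans_le (measureReal_mono (by simp))

lemma poissonCDF_lt_one {b : ℝ≥0} (hb : 0 < b) (n : ℕ) : poissonCDF b n < 1 := by
  have := le_one_sub_poissonCDF b n
  have : 0 < Real.exp (-b) * (b : ℝ) ^ (n + 1) / (n + 1).factorial := by positivity
  linarith

/-! ### Asymptotics of the Gaussian quantiles of a Poisson distribution function -/

open Filter Topology

/-- The latent Gaussian value at which the observation of a Poisson variable of rate `b` passes
from `n` to `n + 1`. -/
noncomputable def poissonLatent (b : ℝ≥0) (n : ℕ) : ℝ :=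
  (stdGaussianQuantile (poissonCDF b n)).toReal

section

variable {b : ℝ≥0} (hb : 0 < b)
include hb

lemma stdGaussianQuantile_poissonCDF (n : ℕ) :
    stdGaussianQuantile (poissonCDF b n) = poissonLatent b n := by
  obtain ⟨r, hr⟩ := exists_stdGaussianCDF_eq (poissonCDF_pos hb n) (poissonCDF_lt_one hb n)
  rw [poissonLatent, ← hr, stdGaussianQuantile_stdGaussianCDF, EReal.toReal_coe]

lemma stdGaussianCDF_poissonLatent (n : ℕ) :
    stdGaussianCDF (poissonLatent b n) = poissonCDF b n := by
  obtain ⟨r, hr⟩ := exists_stdGaussianCDF_eq (poissonCDF_pos hb n) (poissonCDF_lt_one hb n)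
  rw [poissonLatent, ← hr, stdGaussianQuantile_stdGaussianCDF, EReal.toReal_coe]

lemma poissonLatent_lt_succ (n : ℕ) : poissonLatent b n < poissonLatent b (n + 1) := by
  rw [← stdGaussianCDF_strictMono.lt_iff_lt, stdGaussianCDF_poissonLatent hb,
    stdGaussianCDF_poissonLatent hb]
  have := poissonCDF_succ_sub b n
  have : 0 < Real.exp (-b) * (b : ℝ) ^ (n + 1) / (n + 1).factorial := by positivity
  linarith

lemma tendsto_poissonLatent : Tendsto (poissonLatent b) atTop atTop := by
  refine tendsto_atTop.2 fun M => ?_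
  have h1 : stdGaussianCDF M < 1 :=
    (stdGaussianCDF_strictMono (lt_add_one M)).trans_le (cdf_le_one _ _)
  have h2 : Tendsto (fun n : ℕ => (b : ℝ) ^ (n + 1) / (n + 1).factorial) atTop (𝓝 0) :=
    (tendsto_add_atTop_iff_nat 1).2 (FloorSemiring.tendsto_pow_div_factorial_atTop (b : ℝ))
  filter_upwards [h2.eventually (gt_mem_nhds (sub_pos.2 h1))] with n hn
  rw [← stdGaussianCDF_strictMono.le_iff_le, stdGaussianCDF_poissonLatent hb]
  have := one_sub_poissonCDF_le b n
  linarith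

end

/-- Minus the logarithm of `b ^ (n + 1) / (n + 1)!`, which is the main term of the logarithm of
the tail of the Poisson distribution of rate `b`. -/
noncomputable def poissonRate (b : ℝ≥0) (n : ℕ) : ℝ :=
  Real.log (n + 1).factorial - (n + 1) * Real.log b

lemma exp_neg_poissonRate {b : ℝ≥0} (hb : 0 < b) (n : ℕ) :
    Real.exp (-poissonRate b n) = b ^ (n + 1) / (n + 1).factorial := by
  have hb' : (0 : ℝ) < b := hb
  rw [poissonRate, neg_sub, Real.exp_sub, Real.exp_log (by positivity),
    ← Real.exp_log (pow_pos hb' (n + 1)), Real.log_pow]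
  push_cast
  rfl

lemma log_factorial_le {n : ℕ} : Real.log n.factorial ≤ n * Real.log n := by
  rw [← Real.log_pow]
  refine Real.log_le_log (by positivity) ?_
  exact_mod_cast n.factorial_le_pow

lemma abs_poissonRate_sub_le (b : ℝ≥0) :
    ∃ C : ℝ, ∀ n : ℕ, 1 ≤ n → |poissonRate b n - n * Real.log n| ≤ C * n := by
  refine ⟨1 + 2 * |Real.log b|, fun n hn => ?_⟩
  have hn' : (1 : ℝ) ≤ n := by exact_mod_cast hn
  have h1 := Stirling.le_log_factorial_stirling (n := n) (by omega)
  have h2 := log_factorial_le (n := n)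
  have h3 : Real.log (n + 1).factorial = Real.log (n + 1) + Real.log n.factorial := by
    rw [Nat.factorial_succ]
    push_cast
    exact Real.log_mul (by positivity) (by positivity)
  have h4 : Real.log (n + 1) ≤ n := by
    have := Real.log_le_sub_one_of_pos (x := (n : ℝ) + 1) (by positivity)
    linarith
  have h5 : 0 ≤ Real.log (n + 1) := Real.log_nonneg (by linarith)
  have h6 : 0 ≤ Real.log n := Real.log_nonneg hn'
  have h7 : 0 ≤ Real.log (2 * Real.pi) := Real.log_nonneg (by nlinarith [Real.pi_gt_three])
  have h8 : |(n + 1) * Real.log b| ≤ 2 * |Real.log b| * n := by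
    rw [abs_mul, abs_of_nonneg (by positivity)]
    nlinarith [abs_nonneg (Real.log b)]
  have h9 : |Real.log (n + 1).factorial - n * Real.log n| ≤ n := by
    rw [abs_le, h3]
    constructor <;> linarith
  calc |poissonRate b n - n * Real.log n|
      = |(Real.log (n + 1).factorial - n * Real.log n) - (n + 1) * Real.log b| := by
        rw [poissonRate]; ring_nf
    _ ≤ _ := abs_sub _ _
    _ ≤ _ := by linarith

lemma tendsto_log_natCast : Tendsto (fun n : ℕ => Real.log n) atTop atTop :=
  Real.tendsto_log_atTop.comp tendsto_natCast_atTop_atTop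

lemma tendsto_poissonRate_div (b : ℝ≥0) :
    Tendsto (fun n : ℕ => poissonRate b n / (n * Real.log n)) atTop (𝓝 1) := by
  obtain ⟨C, hC⟩ := abs_poissonRate_sub_le b
  rw [tendsto_iff_norm_sub_tendsto_zero]
  have h0 : Tendsto (fun n : ℕ => C / Real.log n) atTop (𝓝 0) :=
    tendsto_const_nhds.div_atTop tendsto_log_natCast
  refine squeeze_zero' (Eventually.of_forall fun _ => norm_nonneg _) ?_ h0
  filter_upwards [eventually_ge_atTop 2] with n hn
  have hn' : (0 : ℝ) < n := by positivity
  have hl : 0 < Real.log n := Real.log_pos (by exact_mod_cast hn)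
  have : poissonRate b n / (n * Real.log n) - 1
      = (poissonRate b n - n * Real.log n) / (n * Real.log n) := by field_simp
  rw [this, norm_div, Real.norm_eq_abs, Real.norm_eq_abs, abs_of_pos (by positivity : 0 < n * Real.log n),
    div_le_div_iff₀ (by positivity) hl]
  nlinarith [hC n (by omega)]

section

variable {b : ℝ≥0} (hb : 0 < b)
include hb

/-- The Gaussian and Poisson tails agree at the latent value: the upper bound for one is played
against the lower bound for the other, here and, with the roles exchanged, in `le_poissonLatent_sq`.
-/
lemma poissonLatent_sq_le (n : ℕ) (h : 0 ≤ poissonLatent b n) :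
    poissonLatent b n ^ 2 ≤ 2 * poissonRate b n + 2 * b := by
  have h1 := one_sub_stdGaussianCDF_le h
  have h2 := le_one_sub_poissonCDF b n
  rw [stdGaussianCDF_poissonLatent hb] at h1
  rw [mul_div_assoc, ← exp_neg_poissonRate hb, ← Real.exp_add] at h2
  have := Real.exp_le_exp.1 (h2.trans h1)
  linarith

lemma le_poissonLatent_sq (n : ℕ) (h : 1 ≤ poissonLatent b n) :
    2 * poissonRate b n - 6 - 2 * Real.log (poissonLatent b n) ≤ poissonLatent b n ^ 2 := by
  have h1 := le_one_sub_stdGaussianCDF h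
  have h2 := one_sub_poissonCDF_le b n
  have h0 : 0 < poissonLatent b n := by linarith
  rw [stdGaussianCDF_poissonLatent hb] at h1
  rw [← exp_neg_poissonRate hb] at h2
  nth_rewrite 2 [← Real.exp_log h0] at h1
  rw [← Real.exp_sub] at h1
  have := Real.exp_le_exp.1 (h1.trans h2)
  linarith

lemma eventually_poissonLatent_le : ∀ᶠ n : ℕ in atTop, poissonLatent b n ≤ n := by
  have h1 : ∀ᶠ n : ℕ in atTop, poissonRate b n / (n * Real.log n) ≤ 2 :=
    (tendsto_poissonRate_div b).eventually (ge_mem_nhds (by norm_num))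
  have h3 : ∀ᶠ n : ℕ in atTop, Real.log n ≤ 1 / 8 * n := by
    have := (Real.isLittleO_log_id_atTop.comp_tendsto tendsto_natCast_atTop_atTop).bound
      (by norm_num : (0 : ℝ) < 1 / 8)
    filter_upwards [this] with n hn
    simp only [Function.comp, id, Real.norm_eq_abs, Nat.abs_cast] at hn
    exact (le_abs_self _).trans hn
  have h4 : ∀ᶠ n : ℕ in atTop, 4 * (b : ℝ) ≤ n :=
    tendsto_natCast_atTop_atTop.eventually (eventually_ge_atTop _)
  filter_upwards [h1, h3, h4, eventually_ge_atTop 2,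
    (tendsto_poissonLatent hb).eventually (eventually_ge_atTop 0)] with n h1 h3 h4 h5 h6
  have hl : 0 < Real.log n := Real.log_pos (by exact_mod_cast h5)
  have h5' : (2 : ℝ) ≤ n := by exact_mod_cast h5
  rw [div_le_iff₀ (by positivity)] at h1
  refine le_of_sq_le_sq ?_ (by positivity)
  have := poissonLatent_sq_le hb n h6
  nlinarith

/-- The logarithmic error is what makes the rate visible: `b` enters `poissonRate b n` through a
term of order `n`. -/
lemma eventually_abs_poissonLatent_sq_sub_le :
    ∀ᶠ n : ℕ in atTop, |poissonLatent b n ^ 2 - 2 * poissonRate b n| ≤ 3 * Real.log n := by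
  filter_upwards [eventually_poissonLatent_le hb,
    (tendsto_poissonLatent hb).eventually (eventually_ge_atTop 1),
    tendsto_log_natCast.eventually (eventually_ge_atTop 6),
    tendsto_log_natCast.eventually (eventually_ge_atTop (b : ℝ))] with n h1 h2 h3 h4
  have h5 := poissonLatent_sq_le hb n (by linarith)
  have h6 := le_poissonLatent_sq hb n h2
  have h7 := Real.log_le_log (by linarith) h1
  rw [abs_le]
  constructor <;> linarith

lemma tendsto_poissonLatent_sq_div :
    Tendsto (fun n : ℕ => poissonLatent b n ^ 2 / (n * Real.log n)) atTop (𝓝 2) := by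
  have h1 : Tendsto (fun n : ℕ => (poissonLatent b n ^ 2 - 2 * poissonRate b n) / (n * Real.log n))
      atTop (𝓝 0) := by
    refine squeeze_zero_norm' ?_ (tendsto_const_nhds.div_atTop tendsto_natCast_atTop_atTop :
      Tendsto (fun n : ℕ => (3 : ℝ) / n) atTop (𝓝 0))
    filter_upwards [eventually_abs_poissonLatent_sq_sub_le hb, eventually_ge_atTop 2] with n hn h2
    have hn' : (0 : ℝ) < n := by positivity
    have hl : 0 < Real.log n := Real.log_pos (by exact_mod_cast h2)
    rw [norm_div, Real.norm_eq_abs, Real.norm_eq_abs,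
      abs_of_pos (by positivity : 0 < n * Real.log n), div_le_div_iff₀ (by positivity) hn']
    nlinarith
  have h2 := h1.add ((tendsto_poissonRate_div b).const_mul 2)
  rw [zero_add, mul_one] at h2
  refine h2.congr fun n => ?_
  ring

end

/-- The speed at which the continuous variables and the latent variables grow along the sequences
of observations where the components are compared. -/
noncomputable def speed (m : ℕ) : ℝ := Real.sqrt (2 * m * Real.log m)

lemma speed_nonneg (m : ℕ) : 0 ≤ speed m := Real.sqrt_nonneg _

lemma speed_sq (m : ℕ) : speed m ^ 2 = 2 * m * Real.log m :=
  Real.sq_sqrt (mul_nonneg (by positivity) (Real.log_natCast_nonneg m))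

lemma tendsto_speed : Tendsto speed atTop atTop := by
  refine Real.tendsto_sqrt_atTop.comp (Tendsto.atTop_mul_atTop₀ ?_ tendsto_log_natCast)
  exact tendsto_natCast_atTop_atTop.const_mul_atTop (by norm_num)

lemma tendsto_div_speed : Tendsto (fun m : ℕ => m / speed m) atTop atTop := by
  have h : Tendsto (fun m : ℕ => Real.sqrt (m / (2 * Real.log m))) atTop atTop := by
    refine Real.tendsto_sqrt_atTop.comp ?_
    have h0 : Tendsto (fun m : ℕ => 2 * Real.log m / m) atTop (𝓝[>] 0) := by
      refine tendsto_nhdsWithin_iff.2 ⟨?_, ?_⟩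
      · have h1 := (Real.isLittleO_log_id_atTop.tendsto_div_nhds_zero.comp
          tendsto_natCast_atTop_atTop).const_mul 2
        rw [mul_zero] at h1
        refine h1.congr fun m => ?_
        simp [mul_div_assoc]
      · filter_upwards [eventually_ge_atTop 2] with m hm
        have hl : 0 < Real.log m := Real.log_pos (by exact_mod_cast hm)
        have : 0 < m := by omega
        exact Set.mem_Ioi.2 (by positivity)
    refine h0.inv_tendsto_nhdsGT_zero.congr fun m => ?_
    simp
  refine h.congr' ?_
  filter_upwards [eventually_ge_atTop 2] with m hm
  have hl : 0 < Real.log m := Real.log_pos (by exact_mod_cast hm)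
  have hm' : (0 : ℝ) < m := by positivity
  rw [Real.sqrt_eq_iff_mul_self_eq (by positivity) (div_nonneg hm'.le (speed_nonneg m)),
    div_mul_div_comm, ← sq (speed m), speed_sq]
  field_simp

lemma tendsto_sq_mul_atTop {v : ℕ} (hv : 0 < v) : Tendsto (fun m : ℕ => v ^ 2 * m) atTop atTop :=
  tendsto_id.const_mul_atTop' (by positivity)

lemma tendsto_log_sq_mul_div {v : ℕ} (hv : 0 < v) :
    Tendsto (fun m : ℕ => Real.log (v ^ 2 * m : ℕ) / Real.log m) atTop (𝓝 1) := by
  have h : Tendsto (fun m : ℕ => Real.log (v ^ 2 : ℕ) / Real.log m + 1) atTop (𝓝 (0 + 1)) :=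
    (tendsto_const_nhds.div_atTop tendsto_log_natCast).add_const 1
  rw [zero_add] at h
  refine h.congr' ?_
  filter_upwards [eventually_ge_atTop 2] with m hm
  have hl : 0 < Real.log m := Real.log_pos (by exact_mod_cast hm)
  have hm' : (0 : ℝ) < m := by positivity
  rw [Nat.cast_mul, Real.log_mul (by positivity) hm'.ne', add_div, div_self hl.ne']

/-- As `log (v ^ 2 * m) ~ log m`, the squared latent value is equivalent to `2 * v ^ 2 * m * log m`.
Squaring `v` in the count thus makes the latent value linear in `v`. -/
lemma tendsto_poissonLatent_div_speed {b : ℝ≥0} (hb : 0 < b) {v : ℕ} (hv : 0 < v) :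
    Tendsto (fun m : ℕ => poissonLatent b (v ^ 2 * m) / speed m) atTop (𝓝 v) := by
  have h1 := (tendsto_poissonLatent_sq_div hb).comp (tendsto_sq_mul_atTop hv)
  have h2 := ((h1.mul (tendsto_log_sq_mul_div hv)).mul_const ((v : ℝ) ^ 2 / 2)).sqrt
  have h3 : (2 * 1 * ((v : ℝ) ^ 2 / 2)) = v ^ 2 := by ring
  rw [h3, Real.sqrt_sq (by positivity)] at h2
  refine h2.congr' ?_
  filter_upwards [eventually_ge_atTop 2, ((tendsto_poissonLatent hb).comp
    (tendsto_sq_mul_atTop hv)).eventually (eventually_ge_atTop 0)] with m hm hq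
  have hl : 0 < Real.log m := Real.log_pos (by exact_mod_cast hm)
  have hm' : (0 : ℝ) < m := by positivity
  have hvm : 2 ≤ v ^ 2 * m := by nlinarith [pow_pos hv 2]
  have hl' : 0 < Real.log (v ^ 2 * m : ℕ) := Real.log_pos (by exact_mod_cast hvm)
  have hv' : (0 : ℝ) < v := by exact_mod_cast hv
  simp only [Function.comp] at hq ⊢
  rw [← Real.sqrt_sq (div_nonneg hq (speed_nonneg m)), div_pow, speed_sq]
  congr 1
  push_cast at hl' ⊢
  field_simp

/-- Consecutive squares differ by `O(log n)`, while the sum of the two latent values is at least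
`√n`. -/
lemma tendsto_poissonLatent_succ_sub {b : ℝ≥0} (hb : 0 < b) :
    Tendsto (fun n : ℕ => poissonLatent b (n + 1) - poissonLatent b n) atTop (𝓝 0) := by
  have hlog : Tendsto (fun n : ℕ => 10 * (Real.log n / Real.sqrt n)) atTop (𝓝 0) := by
    have := ((isLittleO_log_rpow_atTop (by norm_num : (0 : ℝ) < 1 / 2)).tendsto_div_nhds_zero.comp
      tendsto_natCast_atTop_atTop).const_mul 10
    rw [mul_zero] at this
    refine this.congr fun n => ?_
    simp [Real.sqrt_eq_rpow]
  refine squeeze_zero' (Eventually.of_forall fun n => (sub_pos.2 (poissonLatent_lt_succ hb n)).le)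
    ?_ hlog
  have h1 := eventually_abs_poissonLatent_sq_sub_le hb
  have h2 := (tendsto_add_atTop_nat 1).eventually h1
  have h3 : ∀ᶠ n : ℕ in atTop, 1 ≤ poissonLatent b n ^ 2 / (n * Real.log n) :=
    (tendsto_poissonLatent_sq_div hb).eventually (le_mem_nhds (by norm_num))
  filter_upwards [h1, h2, h3, tendsto_log_natCast.eventually (eventually_ge_atTop 1),
    tendsto_log_natCast.eventually (eventually_ge_atTop (2 * |Real.log b| + 5 * Real.log 3)),
    (tendsto_poissonLatent hb).eventually (eventually_ge_atTop 0),
    eventually_ge_atTop 1] with n h1 h2 h3 h4 h5 h6 h7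
  have hn : (1 : ℝ) ≤ n := by exact_mod_cast h7
  rw [le_div_iff₀ (by positivity)] at h3
  have hs : Real.sqrt n ≤ poissonLatent b n := by
    rw [Real.sqrt_le_left h6]
    nlinarith
  have hs0 : 0 < Real.sqrt n := Real.sqrt_pos.2 (by linarith)
  have hlt := poissonLatent_lt_succ hb n
  have hd : poissonRate b (n + 1) - poissonRate b n = Real.log (n + 2) - Real.log b := by
    rw [poissonRate, poissonRate, Nat.factorial_succ (n + 1), Nat.cast_mul,
      Real.log_mul (by positivity) (by positivity)]
    push_cast
    ring_nf
  have hl2 : Real.log (n + 2) ≤ Real.log n + Real.log 3 := by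
    rw [← Real.log_mul (by positivity) (by norm_num)]
    exact Real.log_le_log (by positivity) (by linarith)
  have hl1 : Real.log (n + 1 : ℕ) ≤ Real.log n + Real.log 3 := by
    rw [← Real.log_mul (by positivity) (by norm_num)]
    refine Real.log_le_log (by positivity) ?_
    push_cast
    linarith
  rw [← mul_div_assoc, le_div_iff₀ hs0]
  have hb1 := neg_abs_le (Real.log b)
  have := (abs_le.1 h1).1
  have := (abs_le.1 h2).2
  calc (poissonLatent b (n + 1) - poissonLatent b n) * Real.sqrt n
      ≤ (poissonLatent b (n + 1) - poissonLatent b n)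
        * (poissonLatent b (n + 1) + poissonLatent b n) := by
        gcongr
        linarith
    _ = poissonLatent b (n + 1) ^ 2 - poissonLatent b n ^ 2 := by ring
    _ ≤ 10 * Real.log n := by linarith

/-- The interval carries the Poisson mass of `n + 1`, comparable to the Poisson tail beyond `n`, and
the Gaussian density on it is at most of order `q` times that same tail. The exponentials cancel and
the width is at least of order `1 / q`. -/
lemma one_le_mul_poissonLatent_succ_sub {b : ℝ≥0} (hb : 0 < b) {n : ℕ}
    (h : 1 ≤ poissonLatent b n) :
    1 ≤ Real.exp (3 + b) * poissonLatent b n * (poissonLatent b (n + 1) - poissonLatent b n) := by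
  have h0 : 0 < poissonLatent b n := by linarith
  have h1 := stdGaussianCDF_sub_le (poissonLatent_lt_succ hb n).le (fun x hx =>
    (gaussianPDFReal_std_anti h0.le hx).trans (gaussianPDFReal_std_le_exp _))
  rw [stdGaussianCDF_poissonLatent hb, stdGaussianCDF_poissonLatent hb, poissonCDF_succ_sub,
    mul_div_assoc, ← exp_neg_poissonRate hb, ← Real.exp_add] at h1
  have h2 := le_one_sub_stdGaussianCDF h
  have h3 := one_sub_poissonCDF_le b n
  rw [stdGaussianCDF_poissonLatent hb] at h2
  rw [← exp_neg_poissonRate hb] at h3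
  have h4 := h2.trans h3
  rw [div_le_iff₀ h0] at h4
  set q := poissonLatent b n
  set w := poissonLatent b (n + 1) - q
  have hw : 0 < w := sub_pos.2 (poissonLatent_lt_succ hb n)
  have h5 : Real.exp (-q ^ 2 / 2) = Real.exp 3 * Real.exp (-q ^ 2 / 2 - 3) := by
    rw [← Real.exp_add]; ring_nf
  rw [h5] at h1
  have h6 : Real.exp (-b + -poissonRate b n)
      ≤ Real.exp 3 * (Real.exp (-poissonRate b n) * q) * w := by
    refine h1.trans ?_
    gcongr
  have h7 : Real.exp (-b + -poissonRate b n) * 1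
      ≤ Real.exp (-b + -poissonRate b n) * (Real.exp (3 + b) * q * w) := by
    rw [mul_one]
    refine h6.trans_eq ?_
    rw [show (Real.exp (-b + -poissonRate b n) * (Real.exp (3 + b) * q * w)) =
      (Real.exp (-b + -poissonRate b n) * Real.exp (3 + b)) * q * w by ring, ← Real.exp_add,
      show -(b : ℝ) + -poissonRate b n + (3 + b) = 3 + -poissonRate b n by ring, Real.exp_add]
    ring
  exact le_of_mul_le_mul_left h7 (Real.exp_pos _)

lemma tendsto_log_poissonLatent_succ_sub_div_speed {b : ℝ≥0} (hb : 0 < b) {v : ℕ} (hv : 0 < v) :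
    Tendsto (fun m : ℕ => Real.log (poissonLatent b (v ^ 2 * m + 1) - poissonLatent b (v ^ 2 * m))
      / speed m) atTop (𝓝 0) := by
  have hq := (tendsto_poissonLatent hb).comp (tendsto_sq_mul_atTop hv)
  have h1 : Tendsto (fun m : ℕ => (3 + b) / speed m + Real.log (poissonLatent b (v ^ 2 * m))
      / poissonLatent b (v ^ 2 * m) * (poissonLatent b (v ^ 2 * m) / speed m)) atTop (𝓝 0) := by
    have := (tendsto_const_nhds (x := 3 + (b : ℝ))).div_atTop tendsto_speed
    have h2 := (Real.isLittleO_log_id_atTop.tendsto_div_nhds_zero.comp hq).mul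
      (tendsto_poissonLatent_div_speed hb hv)
    rw [zero_mul] at h2
    simpa using this.add h2
  refine squeeze_zero_norm' ?_ h1
  filter_upwards [hq.eventually (eventually_ge_atTop 1), tendsto_speed.eventually
    (eventually_gt_atTop 0), ((tendsto_poissonLatent_succ_sub hb).comp
    (tendsto_sq_mul_atTop hv)).eventually (ge_mem_nhds one_pos)] with m h1 h2 h3
  simp only [Function.comp] at h1 h3
  have h4 := one_le_mul_poissonLatent_succ_sub hb h1
  have hw := sub_pos.2 (poissonLatent_lt_succ hb (v ^ 2 * m))
  set q := poissonLatent b (v ^ 2 * m)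
  set w := poissonLatent b (v ^ 2 * m + 1) - q
  have hq0 : 0 < q := by linarith
  rw [Real.norm_eq_abs, abs_div, abs_of_pos h2, div_mul_div_cancel₀ hq0.ne', ← add_div]
  gcongr
  rw [abs_of_nonpos (Real.log_nonpos hw.le h3)]
  have h5 := Real.log_nonneg h4
  rw [Real.log_mul (by positivity) hw.ne', Real.log_mul (by positivity) hq0.ne', Real.log_exp] at h5
  linarith

/-- Divide the difference of squares, about `2 * v ^ 2 * m * (log b' - log b)`, by the sum of the
latent values, about `2 * v * speed m`. -/
lemma tendsto_poissonLatent_sub {b b' : ℝ≥0} (hb : 0 < b) (hb' : 0 < b') {v : ℕ} (hv : 0 < v) :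
    Tendsto (fun m : ℕ => (poissonLatent b (v ^ 2 * m) - poissonLatent b' (v ^ 2 * m))
      / (m / speed m)) atTop (𝓝 (v * (Real.log b' - Real.log b))) := by
  have hv' : (0 : ℝ) < v := by exact_mod_cast hv
  have hn := tendsto_sq_mul_atTop hv
  have h0 : Tendsto (fun n : ℕ => (poissonLatent b n ^ 2 - poissonLatent b' n ^ 2
      - 2 * (poissonRate b n - poissonRate b' n)) / n) atTop (𝓝 0) := by
    have hlog := (Real.isLittleO_log_id_atTop.tendsto_div_nhds_zero.comp
          tendsto_natCast_atTop_atTop).const_mul 6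
    rw [mul_zero] at hlog
    refine squeeze_zero_norm' ?_ hlog
    filter_upwards [eventually_abs_poissonLatent_sq_sub_le hb,
      eventually_abs_poissonLatent_sq_sub_le hb'] with n h1 h2
    rw [Real.norm_eq_abs, abs_div, Nat.abs_cast]
    simp only [Function.comp, id]
    rw [← mul_div_assoc]
    gcongr
    rw [abs_le] at *
    constructor <;> linarith
  have h1 : Tendsto (fun n : ℕ => 2 * ((poissonRate b n - poissonRate b' n) / n)) atTop
      (𝓝 (2 * (Real.log b' - Real.log b))) := by
    have h : Tendsto (fun n : ℕ => (1 + 1 / (n : ℝ)) * (Real.log b' - Real.log b)) atTop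
        (𝓝 ((1 + 0) * (Real.log b' - Real.log b))) :=
      ((tendsto_const_nhds.div_atTop tendsto_natCast_atTop_atTop).const_add 1).mul_const _
    rw [add_zero, one_mul] at h
    refine (h.congr' ?_).const_mul 2
    filter_upwards [eventually_gt_atTop 0] with n hn
    have : (0 : ℝ) < n := by exact_mod_cast hn
    rw [poissonRate, poissonRate]
    field_simp
    ring
  have h2 := ((h0.add h1).comp hn).mul_const ((v : ℝ) ^ 2)
  have h3 := (tendsto_poissonLatent_div_speed hb hv).add (tendsto_poissonLatent_div_speed hb' hv)
  have h4 := h2.div h3 (by positivity)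
  have h5 : (0 + 2 * (Real.log b' - Real.log b)) * (v : ℝ) ^ 2 / (v + v)
      = v * (Real.log b' - Real.log b) := by field_simp; ring
  rw [h5] at h4
  refine h4.congr' ?_
  filter_upwards [eventually_gt_atTop 0, tendsto_speed.eventually (eventually_gt_atTop 0),
    ((tendsto_poissonLatent hb).comp hn).eventually (eventually_gt_atTop 0),
    ((tendsto_poissonLatent hb').comp hn).eventually (eventually_gt_atTop 0)] with m h1 h2 h3 h4
  have hm : (0 : ℝ) < m := by exact_mod_cast h1
  simp only [Function.comp] at h3 h4
  simp only [Pi.div_apply, Function.comp]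
  have : 0 < poissonLatent b (v ^ 2 * m) + poissonLatent b' (v ^ 2 * m) := by positivity
  push_cast
  field_simp
  ring

/-! ### The density as the integral of a Gaussian density over a box -/

open Matrix

/-- Completing the square: eliminating the first block from the linear system leaves the Schur
complement acting on the second. This glues the marginal and conditional exponents into a joint one.
-/
lemma dotProduct_inv_fromBlocks_mulVec {m n : Type*} [Fintype m] [Fintype n] [DecidableEq m]
    [DecidableEq n] {A : Matrix m m ℝ} {B : Matrix m n ℝ} {D : Matrix n n ℝ}
    (hA : A.IsSymm) (hA' : IsUnit A.det) (hS : IsUnit (D - Bᵀ * A⁻¹ * B).det)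
    (hG : IsUnit (fromBlocks A B Bᵀ D).det) (y : m → ℝ) (u : n → ℝ) :
    Sum.elim y u ⬝ᵥ (fromBlocks A B Bᵀ D)⁻¹ *ᵥ Sum.elim y u
      = y ⬝ᵥ A⁻¹ *ᵥ y + (u - (Bᵀ * A⁻¹) *ᵥ y) ⬝ᵥ
        (D - Bᵀ * A⁻¹ * B)⁻¹ *ᵥ (u - (Bᵀ * A⁻¹) *ᵥ y) := by
  obtain ⟨w₁, w₂, hw⟩ : ∃ w₁ w₂, (fromBlocks A B Bᵀ D)⁻¹ *ᵥ Sum.elim y u = Sum.elim w₁ w₂ :=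
    ⟨_, _, (Sum.elim_comp_inl_inr _).symm⟩
  have hz : fromBlocks A B Bᵀ D *ᵥ Sum.elim w₁ w₂ = Sum.elim y u := by
    rw [← hw, mulVec_mulVec, mul_nonsing_inv _ hG, one_mulVec]
  rw [fromBlocks_mulVec] at hz
  have hy : A *ᵥ w₁ + B *ᵥ w₂ = y := funext fun i => by simpa using congrFun hz (Sum.inl i)
  have hu : Bᵀ *ᵥ w₁ + D *ᵥ w₂ = u := funext fun i => by simpa using congrFun hz (Sum.inr i)
  have hAy : A⁻¹ *ᵥ y = w₁ + (A⁻¹ * B) *ᵥ w₂ := by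
    rw [← hy, mulVec_add, mulVec_mulVec, mulVec_mulVec, nonsing_inv_mul _ hA', one_mulVec]
  have hSw : u - (Bᵀ * A⁻¹) *ᵥ y = (D - Bᵀ * A⁻¹ * B) *ᵥ w₂ := by
    rw [← mulVec_mulVec, hAy, ← hu, mulVec_add, mulVec_mulVec, sub_mulVec, Matrix.mul_assoc]
    abel
  have hSw' : (D - Bᵀ * A⁻¹ * B)⁻¹ *ᵥ (u - (Bᵀ * A⁻¹) *ᵥ y) = w₂ := by
    rw [hSw, mulVec_mulVec, nonsing_inv_mul _ hS, one_mulVec]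
  have hB : (Bᵀ * A⁻¹) *ᵥ y ⬝ᵥ w₂ = y ⬝ᵥ (A⁻¹ * B) *ᵥ w₂ := by
    rw [dotProduct_mulVec, ← mulVec_transpose, transpose_mul, transpose_nonsing_inv, hA.eq]
  rw [hSw', hw, hAy, sumElim_dotProduct_sumElim, sub_dotProduct, hB, dotProduct_add]
  ring

lemma abs_dotProduct_mulVec_sub_le {ι : Type*} [Fintype ι] (Q : Matrix ι ι ℝ) {y z : ι → ℝ}
    {δ R : ℝ} (hδ : ∀ i, |y i - z i| ≤ δ) (hR : ∀ i, |z i| ≤ R) :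
    |y ⬝ᵥ Q *ᵥ y - z ⬝ᵥ Q *ᵥ z| ≤ (∑ i, ∑ j, |Q i j|) * (δ * (2 * R + δ)) := by
  have h : y ⬝ᵥ Q *ᵥ y - z ⬝ᵥ Q *ᵥ z = ∑ i, ∑ j, Q i j * (y i * y j - z i * z j) := by
    simp only [dotProduct, mulVec, Finset.mul_sum, ← Finset.sum_sub_distrib]
    exact Finset.sum_congr rfl fun i _ => Finset.sum_congr rfl fun j _ => by ring
  rw [h, Finset.sum_mul]
  refine (Finset.abs_sum_le_sum_abs _ _).trans (Finset.sum_le_sum fun i _ => ?_)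
  rw [Finset.sum_mul]
  refine (Finset.abs_sum_le_sum_abs _ _).trans (Finset.sum_le_sum fun j _ => ?_)
  rw [abs_mul]
  gcongr
  have h1 : y i * y j - z i * z j
      = (y i - z i) * (y j - z j) + (y i - z i) * z j + z i * (y j - z j) := by ring
  rw [h1]
  have hδ0 : 0 ≤ δ := (abs_nonneg _).trans (hδ i)
  have hR0 : 0 ≤ R := (abs_nonneg _).trans (hR i)
  calc _ ≤ |(y i - z i) * (y j - z j)| + |(y i - z i) * z j| + |z i * (y j - z j)| :=
        abs_add_three _ _ _
    _ = |y i - z i| * |y j - z j| + |y i - z i| * |z j| + |z i| * |y j - z j| := by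
        simp only [abs_mul]
    _ ≤ δ * δ + δ * R + R * δ := by
        have := hδ i; have := hδ j; have := hR i; have := hR j
        gcongr
    _ = _ := by ring

lemma setIntegral_pi_Ioc_mem_Icc {d : ℕ} {f : (Fin d → ℝ) → ℝ} (hf : Continuous f)
    {p q : Fin d → ℝ} (hpq : ∀ j, p j ≤ q j) {l r : ℝ}
    (h : ∀ u, (∀ j, u j ∈ Set.Ioc (p j) (q j)) → f u ∈ Set.Icc l r) :
    ∫ u in {u : Fin d → ℝ | ∀ j, u j ∈ Set.Ioc (p j) (q j)}, f u
      ∈ Set.Icc (l * ∏ j, (q j - p j)) (r * ∏ j, (q j - p j)) := by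
  have hs : {u : Fin d → ℝ | ∀ j, u j ∈ Set.Ioc (p j) (q j)}
      = Set.pi Set.univ fun j => Set.Ioc (p j) (q j) := by ext; simp
  have hm : MeasurableSet (Set.pi Set.univ fun j => Set.Ioc (p j) (q j)) :=
    MeasurableSet.univ_pi fun _ => measurableSet_Ioc
  have hv : volume.real (Set.pi Set.univ fun j => Set.Ioc (p j) (q j)) = ∏ j, (q j - p j) := by
    rw [measureReal_def, Real.volume_pi_Ioc_toReal hpq]
  have hfin : volume (Set.pi Set.univ fun j => Set.Ioc (p j) (q j)) ≠ ⊤ := by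
    rw [Real.volume_pi_Ioc]
    exact ENNReal.prod_ne_top fun _ _ => ENNReal.ofReal_ne_top
  have hint : IntegrableOn f (Set.pi Set.univ fun j => Set.Ioc (p j) (q j)) := by
    refine (hf.continuousOn.integrableOn_compact (isCompact_Icc (a := p) (b := q))).mono_set ?_
    rw [← Set.pi_univ_Icc]
    exact Set.pi_mono fun _ _ => Set.Ioc_subset_Icc_self
  have hc : ∀ k : ℝ, ∫ _u in Set.pi Set.univ fun j => Set.Ioc (p j) (q j), k
      = k * ∏ j, (q j - p j) := fun k => by rw [setIntegral_const, hv, smul_eq_mul, mul_comm]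
  rw [hs, ← hc l, ← hc r]
  exact ⟨setIntegral_mono_on (integrableOn_const hfin) hint hm fun u hu =>
      (h u fun j => hu j trivial).1,
    setIntegral_mono_on hint (integrableOn_const hfin) hm fun u hu =>
      (h u fun j => hu j trivial).2⟩

/-! ### Joint covariance, and the logarithm of the density along the observations -/

namespace Component

variable {c d : ℕ} (a : Component c d)

/-- The standard deviations of the continuous variables, and `1` for the latent coordinates of the
integer variables. -/
def scale : Fin c ⊕ Fin d → ℝ := Sum.elim a.sd 1

/-- The covariance matrix of the continuous variables and of the latent coordinates of the
integer variables. -/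
def cov : Matrix (Fin c ⊕ Fin d) (Fin c ⊕ Fin d) ℝ :=
  diagonal a.scale * a.corr * diagonal a.scale

lemma scale_pos (i : Fin c ⊕ Fin d) : 0 < a.scale i := by
  cases i with
  | inl j => exact a.sd_pos j
  | inr j => exact one_pos

lemma cov_apply (i j : Fin c ⊕ Fin d) : a.cov i j = a.scale i * a.corr i j * a.scale j := by
  simp [cov, diagonal_mul, mul_diagonal]

lemma isUnit_diagonal_scale : IsUnit (diagonal a.scale) := by
  rw [isUnit_iff_isUnit_det, det_diagonal]
  exact (Finset.prod_pos fun i _ => a.scale_pos i).ne'.isUnit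

lemma cov_posDef : a.cov.PosDef := by
  have h := a.isUnit_diagonal_scale.posDef_star_right_conjugate_iff (x := a.corr)
  simp only [star_eq_conjTranspose, diagonal_conjTranspose, star_trivial] at h
  exact h.2 a.corr_posDef

/-- A correlation matrix has unit diagonal, so the diagonal of `cov` gives the squares of the
positive scales, which can then be divided out. -/
lemma sd_eq_and_corr_eq_of_cov_eq {a a' : Component c d} (h : a.cov = a'.cov) :
    a.sd = a'.sd ∧ a.corr = a'.corr := by
  have hs : a.scale = a'.scale := by
    funext i
    have hi := congrFun (congrFun h i) i
    rw [cov_apply, cov_apply, a.corr_diag, a'.corr_diag, mul_one, mul_one] at hi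
    exact (mul_self_inj (a.scale_pos i).le (a'.scale_pos i).le).1 hi
  refine ⟨funext fun j => congrFun hs (Sum.inl j), ?_⟩
  ext i j
  have hi := congrFun (congrFun h i) j
  rw [cov_apply, cov_apply, hs] at hi
  exact mul_left_cancel₀ (a'.scale_pos i).ne' (mul_right_cancel₀ (a'.scale_pos j).ne' hi)

lemma dotProduct_cov_inv_mulVec (z : Fin c ⊕ Fin d → ℝ) :
    (a.scale * z) ⬝ᵥ a.cov⁻¹ *ᵥ (a.scale * z) = z ⬝ᵥ a.corr⁻¹ *ᵥ z := by
  have hs : a.scale * z = diagonal a.scale *ᵥ z := funext fun i => by simp [mulVec_diagonal]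
  have hu := (isUnit_iff_isUnit_det _).1 a.isUnit_diagonal_scale
  have hT : ∀ w, diagonal a.scale *ᵥ z ⬝ᵥ w = z ⬝ᵥ diagonal a.scale *ᵥ w := fun w => by
    rw [dotProduct_mulVec, ← mulVec_transpose, diagonal_transpose]
  rw [hs, cov, Matrix.mul_inv_rev, Matrix.mul_inv_rev, hT, mulVec_mulVec, mulVec_mulVec,
    Matrix.mul_assoc, Matrix.mul_assoc, Matrix.mul_assoc, nonsing_inv_mul _ hu, Matrix.mul_one,
    ← Matrix.mul_assoc,
    mul_nonsing_inv _ hu, Matrix.one_mul]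

/-- Both endpoints are finite for a nonzero count; hence the `+ 1` in the observations. -/
lemma latentInterval_succ (j : Fin d) (n : ℕ) :
    a.latentInterval j (n + 1)
      = Set.Ioc (poissonLatent (a.rate j) n) (poissonLatent (a.rate j) (n + 1)) := by
  ext y
  rw [latentInterval, poissonCDF_natCast_succ_sub_one,
    stdGaussianQuantile_poissonCDF (a.rate_pos j), stdGaussianQuantile_poissonCDF (a.rate_pos j)]
  simp

lemma exists_density_eq : ∃ C : ℝ, 0 < C ∧ ∀ x n, a.density x n =
    C * ∫ u in {u : Fin d → ℝ | ∀ j, u j ∈ a.latentInterval j (n j)},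
      Real.exp (-(Sum.elim (x - a.mean) u ⬝ᵥ a.cov⁻¹ *ᵥ Sum.elim (x - a.mean) u) / 2) := by
  have hpd := a.corr_posDef
  have hsymm : a.corr.IsSymm := by simpa using hpd.isHermitian
  have hB : a.corr.toBlocks₂₁ = a.corr.toBlocks₁₂ᵀ := by
    ext i j
    exact hsymm.apply _ _
  have hblocks : fromBlocks a.corr.toBlocks₁₁ a.corr.toBlocks₁₂ a.corr.toBlocks₁₂ᵀ
      a.corr.toBlocks₂₂ = a.corr := by rw [← hB, fromBlocks_toBlocks]
  have hA : a.corr.toBlocks₁₁.PosDef := hpd.submatrix Sum.inl_injective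
  have hAs : a.corr.toBlocks₁₁.IsSymm := by simpa using hA.isHermitian
  have hAu : IsUnit a.corr.toBlocks₁₁.det := hA.det_pos.ne'.isUnit
  have hdet : a.corr.det = a.corr.toBlocks₁₁.det * a.condCov.det := by
    let := invertibleOfIsUnitDet _ hAu
    rw [← hblocks, det_fromBlocks₁₁, invOf_eq_nonsing_inv, hblocks, condCov, hB]
  have hS : 0 < a.condCov.det := by
    have h1 := hpd.det_pos
    rw [hdet] at h1
    exact pos_of_mul_pos_right h1 hA.det_pos.le
  have hSdef : a.condCov = a.corr.toBlocks₂₂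
      - a.corr.toBlocks₁₂ᵀ * a.corr.toBlocks₁₁⁻¹ * a.corr.toBlocks₁₂ := by rw [condCov, hB]
  have hsd : 0 < ∏ j, a.sd j := Finset.prod_pos fun j _ => a.sd_pos j
  have h2π : (0 : ℝ) < 2 * Real.pi := by positivity
  have hA0 := hA.det_pos
  refine ⟨(Real.sqrt ((2 * Real.pi) ^ c * a.corr.toBlocks₁₁.det))⁻¹ / (∏ j, a.sd j) *
    (Real.sqrt ((2 * Real.pi) ^ d * a.condCov.det))⁻¹, by positivity, fun x n => ?_⟩
  rw [density, ← integral_const_mul, ← integral_const_mul]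
  refine integral_congr_ae (Eventually.of_forall fun u => ?_)
  have hq : Sum.elim (x - a.mean) u ⬝ᵥ a.cov⁻¹ *ᵥ Sum.elim (x - a.mean) u
      = a.latent x ⬝ᵥ a.corr.toBlocks₁₁⁻¹ *ᵥ a.latent x
        + (u - a.condMean x) ⬝ᵥ a.condCov⁻¹ *ᵥ (u - a.condMean x) := by
    have hz : Sum.elim (x - a.mean) u = a.scale * Sum.elim (a.latent x) u := by
      funext i
      cases i with
      | inl j => simp [scale, latent, mul_div_cancel₀ _ (a.sd_pos j).ne']
      | inr j => simp [scale]
    have h1 := dotProduct_inv_fromBlocks_mulVec hAs hAu (hSdef ▸ hS.ne'.isUnit)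
      (by rw [hblocks]; exact hpd.det_pos.ne'.isUnit) (a.latent x) u
    rw [hblocks] at h1
    rw [hz, dotProduct_cov_inv_mulVec, h1, condMean, hSdef, hB]
  simp only [gaussianDensity, sub_zero]
  rw [hq, neg_add, add_div, Real.exp_add]
  ring

/-- The components are compared along the observations whose continuous coordinates are
`speed m * v j` and whose integer coordinates are `v j ^ 2 * m + 1`. This is the vector of the
centered continuous variables and the latent coordinates of the integer variables there. -/
noncomputable def point (v : Fin c ⊕ Fin d → ℕ) (m : ℕ) : Fin c ⊕ Fin d → ℝ :=
  Sum.elim (fun j => speed m * v (Sum.inl j) - a.mean j)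
    (fun j => poissonLatent (a.rate j) (v (Sum.inr j) ^ 2 * m))

/-- The main term of minus the logarithm of the density. -/
noncomputable def energy (v : Fin c ⊕ Fin d → ℕ) (m : ℕ) : ℝ :=
  a.point v m ⬝ᵥ a.cov⁻¹ *ᵥ a.point v m / 2

/-- The density along the observations with continuous coordinates `speed m * v j` and integer
coordinates `v j ^ 2 * m + 1`. -/
noncomputable def densityAlong (v : Fin c ⊕ Fin d → ℕ) (m : ℕ) : ℝ :=
  a.density (fun j => speed m * v (Sum.inl j)) (fun j => v (Sum.inr j) ^ 2 * m + 1)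

variable {v : Fin c ⊕ Fin d → ℕ} (hv : ∀ i, 0 < v i)
include hv

lemma tendsto_point_div_speed (i : Fin c ⊕ Fin d) :
    Tendsto (fun m => a.point v m i / speed m) atTop (𝓝 (v i)) := by
  cases i with
  | inl j =>
    have h := (tendsto_const_nhds (x := a.mean j)).div_atTop tendsto_speed
    have h' := h.const_sub (v (Sum.inl j) : ℝ)
    rw [sub_zero] at h'
    refine h'.congr' ?_
    filter_upwards [tendsto_speed.eventually (eventually_gt_atTop 0)] with m hm
    simp only [point, Sum.elim_inl]
    field_simp
  | inr j => exact tendsto_poissonLatent_div_speed (a.rate_pos j) (hv _)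

omit hv in
-- The box has lower corner `point` and side lengths `w`. Its volume contributes `∑ j, log (w j)`,
-- and the last term bounds the variation of the quadratic form over it.
lemma densityAlong_bounds (v : Fin c ⊕ Fin d → ℕ) : ∃ C K : ℝ, 0 < C ∧ ∀ m,
    ∃ w : Fin d → ℝ, (∀ j, w j = poissonLatent (a.rate j) (v (Sum.inr j) ^ 2 * m + 1)
      - poissonLatent (a.rate j) (v (Sum.inr j) ^ 2 * m)) ∧
    0 < a.densityAlong v m ∧
    |Real.log (a.densityAlong v m) + a.energy v m| ≤ |Real.log C| + |∑ j, Real.log (w j)|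
      + K * ((∑ j, w j) * (2 * (∑ i, |a.point v m i|) + ∑ j, w j)) := by
  obtain ⟨C, hC, hdens⟩ := a.exists_density_eq
  refine ⟨C, (∑ i, ∑ j, |a.cov⁻¹ i j|) / 2, hC, fun m => ⟨_, fun j => rfl, ?_⟩⟩
  set w : Fin d → ℝ := fun j => poissonLatent (a.rate j) (v (Sum.inr j) ^ 2 * m + 1)
      - poissonLatent (a.rate j) (v (Sum.inr j) ^ 2 * m) with hw
  have hw0 : ∀ j, 0 < w j := fun j => sub_pos.2 (poissonLatent_lt_succ (a.rate_pos j) _)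
  set η := (∑ i, ∑ j, |a.cov⁻¹ i j|) / 2 *
    ((∑ j, w j) * (2 * (∑ i, |a.point v m i|) + ∑ j, w j)) with hη
  have hI := setIntegral_pi_Ioc_mem_Icc
    (f := fun u => Real.exp (-(Sum.elim ((fun j => speed m * v (Sum.inl j)) - a.mean) u ⬝ᵥ a.cov⁻¹ *ᵥ
      Sum.elim ((fun j => speed m * v (Sum.inl j)) - a.mean) u) / 2))
    (p := fun j => poissonLatent (a.rate j) (v (Sum.inr j) ^ 2 * m))
    (q := fun j => poissonLatent (a.rate j) (v (Sum.inr j) ^ 2 * m + 1))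
    (l := Real.exp (-a.energy v m - η)) (r := Real.exp (-a.energy v m + η)) ?_
    (fun j => (poissonLatent_lt_succ (a.rate_pos j) _).le) ?_
  · have hd : a.densityAlong v m = C * _ := hdens _ _
    simp only [latentInterval_succ] at hd
    set I := ∫ u in {u : Fin d → ℝ | ∀ j, u j ∈ Set.Ioc
      (poissonLatent (a.rate j) (v (Sum.inr j) ^ 2 * m))
      (poissonLatent (a.rate j) (v (Sum.inr j) ^ 2 * m + 1))}, Real.exp
      (-(Sum.elim ((fun j => speed m * v (Sum.inl j)) - a.mean) u ⬝ᵥ a.cov⁻¹ *ᵥ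
      Sum.elim ((fun j => speed m * v (Sum.inl j)) - a.mean) u) / 2)
    have hW : 0 < ∏ j, w j := Finset.prod_pos fun j _ => hw0 j
    have hI0 : 0 < I := lt_of_lt_of_le (by positivity) hI.1
    refine ⟨hd ▸ by positivity, ?_⟩
    have hl := Real.log_le_log (by positivity) hI.1
    have hr := Real.log_le_log hI0 hI.2
    rw [Real.log_mul (Real.exp_ne_zero _) hW.ne', Real.log_exp,
      Real.log_prod fun j _ => (hw0 j).ne'] at hl hr
    rw [hd, Real.log_mul hC.ne' hI0.ne']
    have h1 := abs_le.1 (le_refl |Real.log C|)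
    have h2 := abs_le.1 (le_refl |∑ j, Real.log (w j)|)
    rw [abs_le]
    constructor <;> linarith
  · have : Continuous fun u : Fin d → ℝ =>
        Sum.elim ((fun j => speed m * v (Sum.inl j)) - a.mean) u := by
      refine continuous_pi fun i => ?_
      cases i with
      | inl j => exact continuous_const
      | inr j => exact continuous_apply j
    have h2 : Continuous fun z : Fin c ⊕ Fin d → ℝ => Real.exp (-(z ⬝ᵥ a.cov⁻¹ *ᵥ z) / 2) := by
      unfold dotProduct mulVec dotProduct
      fun_prop
    exact h2.comp this
  · intro u hu
    -- Sums stand for maxima as uniform bounds over the coordinates. The continuous coordinates do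
    -- not move within the box.
    have hq := abs_dotProduct_mulVec_sub_le a.cov⁻¹
      (y := Sum.elim ((fun j => speed m * v (Sum.inl j)) - a.mean) u) (z := a.point v m)
      (δ := ∑ j, w j) (R := ∑ i, |a.point v m i|) (fun i => ?_)
      (fun i => Finset.single_le_sum (f := fun i => |a.point v m i|)
        (fun _ _ => abs_nonneg _) (Finset.mem_univ i))
    · rw [abs_le] at hq
      rw [energy]
      constructor <;> exact Real.exp_le_exp.2 (by linarith)
    · cases i with
      | inl j => simpa [point] using Finset.sum_nonneg fun j _ => (hw0 j).le
      | inr j =>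
        have h1 : |u j - poissonLatent (a.rate j) (v (Sum.inr j) ^ 2 * m)| ≤ w j := by
          have := hu j
          rw [abs_of_nonneg (by linarith [this.1])]
          simp only [hw]
          linarith [this.2]
        exact h1.trans (Finset.single_le_sum (fun j _ => (hw0 j).le) (Finset.mem_univ j))

lemma tendsto_log_densityAlong_add_energy_div_speed :
    Tendsto (fun m => (Real.log (a.densityAlong v m) + a.energy v m) / speed m) atTop (𝓝 0) := by
  obtain ⟨C, K, hC, h⟩ := a.densityAlong_bounds v
  choose w hw hpos hlog using h
  have hlw : ∀ j, Tendsto (fun m => Real.log (w m j) / speed m) atTop (𝓝 0) := fun j => by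
    simp only [hw]
    exact tendsto_log_poissonLatent_succ_sub_div_speed (a.rate_pos j) (hv _)
  have hwt : Tendsto (fun m => ∑ j, w m j) atTop (𝓝 0) := by
    rw [← Finset.sum_const_zero (ι := Fin d) (s := Finset.univ)]
    refine tendsto_finsetSum _ fun j _ => ?_
    simp only [hw]
    exact (tendsto_poissonLatent_succ_sub (a.rate_pos j)).comp (tendsto_sq_mul_atTop (hv _))
  have hlogs : Tendsto (fun m => |∑ j, Real.log (w m j) / speed m|) atTop (𝓝 0) := by
    have := (tendsto_finsetSum Finset.univ fun j _ => hlw j).abs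
    simpa using this
  have hR : Tendsto (fun m => ∑ i, |a.point v m i / speed m|) atTop (𝓝 (∑ i, |(v i : ℝ)|)) :=
    tendsto_finsetSum _ fun i _ => (a.tendsto_point_div_speed hv i).abs
  have hws := hwt.div_atTop tendsto_speed
  have hC' := (tendsto_const_nhds (x := |Real.log C|)).div_atTop tendsto_speed
  have key := (hC'.add hlogs).add ((hwt.mul ((hR.const_mul 2).add hws)).const_mul K)
  rw [zero_mul, mul_zero, add_zero, add_zero] at key
  refine squeeze_zero_norm' ?_ key
  filter_upwards [tendsto_speed.eventually (eventually_gt_atTop 0)] with m hm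
  rw [Real.norm_eq_abs, abs_div, abs_of_pos hm]
  refine (div_le_div_of_nonneg_right (hlog m) hm.le).trans_eq ?_
  simp only [abs_div, abs_of_pos hm, ← Finset.sum_div]
  field_simp

end Component

/-! ### Comparison of the components -/

/-! ### Nonvanishing of polynomials at positive integer points -/

section QuadraticPolynomial

open MvPolynomial

variable {ι : Type*} [Fintype ι]

/-- The quadratic form of a matrix, as a polynomial. -/
noncomputable def quadPoly (M : Matrix ι ι ℝ) : MvPolynomial ι ℝ :=
  ∑ i, ∑ j, C (M i j) * X i * X j

lemma eval_quadPoly (M : Matrix ι ι ℝ) (x : ι → ℝ) : eval x (quadPoly M) = x ⬝ᵥ M *ᵥ x := by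
  simp only [quadPoly, map_sum, map_mul, eval_C, eval_X, dotProduct, mulVec, Finset.mul_sum]
  exact Finset.sum_congr rfl fun i _ => Finset.sum_congr rfl fun j _ => by ring

variable [DecidableEq ι]

/-- Evaluate at a unit vector. No symmetry is required, as the matrix arising from different rates
need not be symmetric. -/
lemma quadPoly_ne_zero_of_apply_self_ne_zero {M : Matrix ι ι ℝ} {i : ι} (h : M i i ≠ 0) :
    quadPoly M ≠ 0 := by
  intro h0
  have := eval_quadPoly M (Pi.single i 1)
  rw [h0] at this
  simp at this
  exact h this.symm

lemma quadPoly_ne_zero {M : Matrix ι ι ℝ} (hM : M.IsSymm) (h : M ≠ 0) : quadPoly M ≠ 0 := by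
  intro h0
  have hx : ∀ x, x ⬝ᵥ M *ᵥ x = 0 := fun x => by rw [← eval_quadPoly, h0, map_zero]
  refine h (Matrix.ext fun i j => ?_)
  have hi := hx (Pi.single i 1)
  have hj := hx (Pi.single j 1)
  have hij := hx (Pi.single i 1 + Pi.single j 1)
  simp [mulVec_add] at hi hj hij
  have := hM.apply i j
  simp
  linarith

omit [Fintype ι] [DecidableEq ι] in
-- A nonzero polynomial over an infinite domain cannot vanish on a product of infinite sets.
lemma exists_nat_pos_eval_ne_zero {P : MvPolynomial ι ℝ} (hP : P ≠ 0) :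
    ∃ v : ι → ℕ, (∀ i, 0 < v i) ∧ eval (fun i => (v i : ℝ)) P ≠ 0 := by
  by_contra! h
  refine hP (MvPolynomial.funext_set (fun _ => Set.range fun n : ℕ => ((n + 1 : ℕ) : ℝ))
    (fun _ => Set.infinite_range_of_injective fun m n hmn => ?_) fun x hx => ?_)
  · simpa using hmn
  · choose n hn using fun i => hx i trivial
    rw [map_zero, ← h (fun i => n i + 1) fun i => Nat.succ_pos _]
    congr 2
    exact funext fun i => (hn i).symm

end QuadraticPolynomial

lemma continuous_dotProduct_mulVec {ι : Type*} [Fintype ι] (M : Matrix ι ι ℝ) :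
    Continuous fun z : (ι → ℝ) × (ι → ℝ) => z.1 ⬝ᵥ M *ᵥ z.2 := by
  unfold dotProduct mulVec dotProduct
  fun_prop

/-! ### Energy gaps and ratios of densities -/

namespace Component

variable {c d : ℕ} {a a' : Component c d} {v : Fin c ⊕ Fin d → ℕ}

lemma tendsto_point_div_speed_pi (a : Component c d) (hv : ∀ i, 0 < v i) :
    Tendsto (fun m => (speed m)⁻¹ • a.point v m) atTop (𝓝 fun i => (v i : ℝ)) := by
  refine tendsto_pi_nhds.2 fun i => (a.tendsto_point_div_speed hv i).congr fun m => ?_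
  simp [div_eq_inv_mul]

lemma tendsto_energy_div_speed_sq (a : Component c d) (hv : ∀ i, 0 < v i) :
    Tendsto (fun m => a.energy v m / (speed m * speed m)) atTop
      (𝓝 (((fun i => (v i : ℝ)) ⬝ᵥ a.cov⁻¹ *ᵥ fun i => (v i : ℝ)) / 2)) := by
  have h := a.tendsto_point_div_speed_pi hv
  refine ((((continuous_dotProduct_mulVec a.cov⁻¹).tendsto _).comp
    (h.prodMk_nhds h)).div_const 2).congr fun m => ?_
  simp only [Function.comp, energy, smul_dotProduct, mulVec_smul, dotProduct_smul, smul_eq_mul]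
  ring

/-- With a common symmetric form `Q`, the gap is `(z' - z) ⬝ᵥ Q *ᵥ ((z' + z) / 2)`: the first factor
is about `ρ m • δ`, the second about `speed m • v`. -/
lemma tendsto_energy_sub_div (hv : ∀ i, 0 < v i) (hcov : a'.cov = a.cov) {ρ : ℕ → ℝ}
    {δ : Fin c ⊕ Fin d → ℝ}
    (hδ : ∀ i, Tendsto (fun m => (a'.point v m i - a.point v m i) / ρ m) atTop (𝓝 (δ i))) :
    Tendsto (fun m => (a'.energy v m - a.energy v m) / (ρ m * speed m)) atTop
      (𝓝 (δ ⬝ᵥ a.cov⁻¹ *ᵥ fun i => (v i : ℝ))) := by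
  have h1 : Tendsto (fun m => (ρ m)⁻¹ • (a'.point v m - a.point v m)) atTop (𝓝 δ) :=
    tendsto_pi_nhds.2 fun i => (hδ i).congr fun m => by simp [div_eq_inv_mul]
  have h2 := ((a'.tendsto_point_div_speed_pi hv).add
    (a.tendsto_point_div_speed_pi hv)).const_smul (1 / 2 : ℝ)
  have h3 : (1 / 2 : ℝ) • ((fun i => (v i : ℝ)) + fun i => (v i : ℝ)) = fun i => (v i : ℝ) := by
    funext i
    simp
    ring
  rw [h3] at h2
  refine (((continuous_dotProduct_mulVec a.cov⁻¹).tendsto _).comp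
    (h1.prodMk_nhds h2)).congr fun m => ?_
  have hs : a.cov⁻¹.IsSymm := by simpa using a.cov_posDef.inv.isHermitian
  have hc : a'.point v m ⬝ᵥ a.cov⁻¹ *ᵥ a.point v m = a.point v m ⬝ᵥ a.cov⁻¹ *ᵥ a'.point v m := by
    rw [dotProduct_mulVec, ← mulVec_transpose, hs.eq, dotProduct_comm]
  simp only [Function.comp, energy, smul_dotProduct, mulVec_smul, dotProduct_smul, smul_eq_mul,
    ← smul_add, mulVec_add, dotProduct_add, sub_dotProduct, hcov, hc]
  ring

lemma tendsto_densityAlong_div (hv : ∀ i, 0 < v i) {ρ : ℕ → ℝ} (hρ : ∀ᶠ m in atTop, 1 ≤ ρ m)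
    {κ : ℝ} (hκ : 0 < κ)
    (h : Tendsto (fun m => (a'.energy v m - a.energy v m) / (ρ m * speed m)) atTop (𝓝 κ)) :
    Tendsto (fun m => a'.densityAlong v m / a.densityAlong v m) atTop (𝓝 0) := by
  have hpos : ∀ (a : Component c d) m, 0 < a.densityAlong v m := fun a m => by
    obtain ⟨_, _, _, h⟩ := a.densityAlong_bounds v
    obtain ⟨_, _, h, _⟩ := h m
    exact h
  have hlog := (a'.tendsto_log_densityAlong_add_energy_div_speed hv).sub
    (a.tendsto_log_densityAlong_add_energy_div_speed hv)
  rw [sub_zero] at hlog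
  have hbot : Tendsto (fun m => -(κ / 4 * speed m)) atTop atBot :=
    tendsto_neg_atTop_atBot.comp (tendsto_speed.const_mul_atTop (by positivity))
  refine squeeze_zero' (Eventually.of_forall fun m => (div_pos (hpos a' m) (hpos a m)).le) ?_
    (Real.tendsto_exp_atBot.comp hbot)
  -- The gap is at least `κ / 2 * speed m`, and the errors cost at most `κ / 4 * speed m`.
  filter_upwards [hρ, tendsto_speed.eventually (eventually_gt_atTop 0),
    h.eventually (le_mem_nhds (half_lt_self hκ)),
    hlog.eventually (ge_mem_nhds (by positivity : 0 < κ / 4))] with m h1 h2 h3 h4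
  rw [← Real.exp_log (div_pos (hpos a' m) (hpos a m)),
    Real.log_div (hpos a' m).ne' (hpos a m).ne']
  refine Real.exp_le_exp.2 ?_
  rw [le_div_iff₀ (by positivity)] at h3
  rw [← sub_div, div_le_iff₀ h2] at h4
  have : κ / 2 * speed m ≤ κ / 2 * (ρ m * speed m) := by
    gcongr
    exact le_mul_of_one_le_left h2.le h1
  linarith

lemma exists_polynomial_energy (h : a ≠ a') : ∃ P : MvPolynomial (Fin c ⊕ Fin d) ℝ, P ≠ 0 ∧
    ∀ v : Fin c ⊕ Fin d → ℕ, (∀ i, 0 < v i) → MvPolynomial.eval (fun i => (v i : ℝ)) P ≠ 0 →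
    ∃ ρ : ℕ → ℝ, (∀ᶠ m in atTop, 1 ≤ ρ m) ∧ ∃ κ : ℝ, κ ≠ 0 ∧
      Tendsto (fun m => (a'.energy v m - a.energy v m) / (ρ m * speed m)) atTop (𝓝 κ) := by
  have hs : ∀ a : Component c d, a.cov⁻¹.IsSymm := fun a => by
    simpa using a.cov_posDef.inv.isHermitian
  by_cases hcov : a'.cov = a.cov
  swap
  -- Different covariances: the scale is `speed ^ 2`, and rates and means are negligible.
  · refine ⟨quadPoly (a'.cov⁻¹ - a.cov⁻¹), quadPoly_ne_zero ((hs a').sub (hs a)) ?_,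
      fun v hv hP => ⟨speed, tendsto_speed.eventually (eventually_ge_atTop 1), _, ?_,
      ((a'.tendsto_energy_div_speed_sq hv).sub (a.tendsto_energy_div_speed_sq hv)).congr
        fun m => (sub_div _ _ _).symm⟩⟩
    · rw [sub_ne_zero]
      intro hinv
      have h1 := congrArg (fun M => M⁻¹) hinv
      simp only [nonsing_inv_nonsing_inv _ a.cov_posDef.det_pos.ne'.isUnit,
        nonsing_inv_nonsing_inv _ a'.cov_posDef.det_pos.ne'.isUnit] at h1
      exact hcov h1
    · rw [eval_quadPoly, sub_mulVec, dotProduct_sub] at hP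
      rw [← sub_div]
      exact div_ne_zero hP two_ne_zero
  by_cases hrate : a'.rate = a.rate
  swap
  · obtain ⟨j, hj⟩ := Function.ne_iff.1 hrate
    -- Different rates: at scale `m / speed m` the means disappear and the points differ by `v i * l
    -- i`, which gives the quadratic form of `diagonal l * a.cov⁻¹`.
    set l : Fin c ⊕ Fin d → ℝ :=
      Sum.elim 0 fun j => Real.log (a.rate j) - Real.log (a'.rate j) with hl
    refine ⟨quadPoly (diagonal l * a.cov⁻¹),
      quadPoly_ne_zero_of_apply_self_ne_zero (i := Sum.inr j) ?_, fun v hv hP =>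
      ⟨fun m => m / speed m, tendsto_div_speed.eventually (eventually_ge_atTop 1), _, ?_,
        tendsto_energy_sub_div (δ := fun i => v i * l i) hv hcov fun i => ?_⟩⟩
    · rw [diagonal_mul]
      refine mul_ne_zero ?_ a.cov_posDef.inv.diag_pos.ne'
      simp only [hl, Sum.elim_inr]
      intro h0
      exact hj (NNReal.coe_injective (Real.log_injOn_pos (a.rate_pos j) (a'.rate_pos j)
        (sub_eq_zero.1 h0)).symm)
    · rw [eval_quadPoly, ← mulVec_mulVec] at hP
      simpa only [dotProduct, mulVec_diagonal, mul_assoc] using hP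
    · cases i with
      | inl i =>
        have := (tendsto_const_nhds (x := a.mean i - a'.mean i)).div_atTop tendsto_div_speed
        simpa [point, hl] using this
      | inr i => exact tendsto_poissonLatent_sub (a'.rate_pos i) (a.rate_pos i) (hv _)
  have hmean : a'.mean ≠ a.mean := by
    intro hm
    obtain ⟨h1, h2⟩ := sd_eq_and_corr_eq_of_cov_eq hcov
    exact h (Component.ext hm h1 hrate h2).symm
  -- Only the means differ: the points differ by the constant `δ`, and the leading coefficient is a
  -- linear form in `v`, positive at `δ` itself.
  set δ : Fin c ⊕ Fin d → ℝ := Sum.elim (a.mean - a'.mean) 0 with hδ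
  have hδ0 : δ ≠ 0 := by
    intro h0
    refine hmean (funext fun i => (sub_eq_zero.1 ?_).symm)
    exact congrFun h0 (Sum.inl i)
  have heval : ∀ x, MvPolynomial.eval x (∑ i, MvPolynomial.C ((δ ᵥ* a.cov⁻¹) i) *
      MvPolynomial.X i) = δ ⬝ᵥ a.cov⁻¹ *ᵥ x := fun x => by
    rw [dotProduct_mulVec]
    simp [dotProduct]
  refine ⟨∑ i, MvPolynomial.C ((δ ᵥ* a.cov⁻¹) i) * MvPolynomial.X i, ?_, fun v hv hP =>
    ⟨fun _ => 1, Eventually.of_forall fun _ => le_rfl, _, heval _ ▸ hP,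
      tendsto_energy_sub_div hv hcov fun i => ?_⟩⟩
  · intro h0
    have h1 := heval δ
    rw [h0, map_zero] at h1
    have := a.cov_posDef.inv.dotProduct_mulVec_pos hδ0
    rw [star_trivial] at this
    exact this.ne h1
  · refine tendsto_const_nhds.congr fun m => ?_
    cases i <;> simp [point, hδ, hrate]

lemma exists_densityAlong_comparable (S : Finset (Component c d)) :
    ∃ v : Fin c ⊕ Fin d → ℕ, ∀ a ∈ S, ∀ a' ∈ S, a ≠ a' →
      Tendsto (fun m => a'.densityAlong v m / a.densityAlong v m) atTop (𝓝 0) ∨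
      Tendsto (fun m => a.densityAlong v m / a'.densityAlong v m) atTop (𝓝 0) := by
  classical
  have hP : ∀ a a' : Component c d, ∃ P : MvPolynomial (Fin c ⊕ Fin d) ℝ, P ≠ 0 ∧ (a ≠ a' →
      ∀ v : Fin c ⊕ Fin d → ℕ, (∀ i, 0 < v i) → MvPolynomial.eval (fun i => (v i : ℝ)) P ≠ 0 →
      ∃ ρ : ℕ → ℝ, (∀ᶠ m in atTop, 1 ≤ ρ m) ∧ ∃ κ : ℝ, κ ≠ 0 ∧
      Tendsto (fun m => (a'.energy v m - a.energy v m) / (ρ m * speed m)) atTop (𝓝 κ)) := by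
    intro a a'
    by_cases h : a = a'
    -- The default `1` lets the product below run over all pairs, diagonal included.
    · exact ⟨1, one_ne_zero, fun h' => absurd h h'⟩
    · obtain ⟨P, hP, h'⟩ := exists_polynomial_energy h
      exact ⟨P, hP, fun _ => h'⟩
  choose P hP hsep using hP
  obtain ⟨v, hv, hne⟩ := exists_nat_pos_eval_ne_zero
    (Finset.prod_ne_zero_iff.2 fun a (_ : a ∈ S) => Finset.prod_ne_zero_iff.2
      fun a' (_ : a' ∈ S) => hP a a')
  simp only [map_prod, Finset.prod_ne_zero_iff] at hne
  refine ⟨v, fun a ha a' ha' haa' => ?_⟩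
  obtain ⟨ρ, hρ, κ, hκ, hlim⟩ := hsep a a' haa' v hv (hne a ha a' ha')
  rcases lt_or_gt_of_ne hκ with hκ | hκ
  · refine Or.inr (tendsto_densityAlong_div hv hρ (neg_pos.2 hκ) (hlim.neg.congr fun m => ?_))
    rw [← neg_div, neg_sub]
  · exact Or.inl (tendsto_densityAlong_div hv hρ hκ hlim)

end Component

/-! ### Linear independence and identifiability -/

/-- Negligibility is transitive, because ratios multiply; a finite set in which any two members are
comparable therefore has a largest one. -/
lemma exists_dominant {K : Type*} (f : K → ℕ → ℝ) (hf : ∀ k m, f k m ≠ 0) (S : Finset K)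
    (hS : S.Nonempty) (h : ∀ k ∈ S, ∀ l ∈ S, k ≠ l →
      Tendsto (fun m => f l m / f k m) atTop (𝓝 0) ∨
      Tendsto (fun m => f k m / f l m) atTop (𝓝 0)) :
    ∃ k ∈ S, ∀ l ∈ S, l ≠ k → Tendsto (fun m => f l m / f k m) atTop (𝓝 0) := by
  classical
  induction hS using Finset.Nonempty.cons_induction with
  | singleton a => exact ⟨a, by simp, by simp⟩
  | cons a S ha hS ih =>
    obtain ⟨k, hk, hdom⟩ := ih fun k hk l hl =>
      h k (Finset.mem_cons_of_mem hk) l (Finset.mem_cons_of_mem hl)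
    have hka : k ≠ a := fun hka => ha (hka ▸ hk)
    rcases h k (Finset.mem_cons_of_mem hk) a (Finset.mem_cons_self a S) hka with h1 | h1
    · refine ⟨k, Finset.mem_cons_of_mem hk, fun l hl hlk => ?_⟩
      rcases Finset.mem_cons.1 hl with rfl | hl
      · exact h1
      · exact hdom l hl hlk
    · refine ⟨a, Finset.mem_cons_self a S, fun l hl hla => ?_⟩
      rcases Finset.mem_cons.1 hl with rfl | hl
      · exact absurd rfl hla
      · by_cases hlk : l = k
        · exact hlk ▸ h1
        · have h2 := (hdom l hl hlk).mul h1
          rw [zero_mul] at h2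
          exact h2.congr fun m => div_mul_div_cancel₀ (hf k m)

lemma eq_zero_of_sum_mul_eq_zero {K : Type*} (f : K → ℕ → ℝ) (hf : ∀ k m, f k m ≠ 0)
    (S : Finset K) (h : ∀ k ∈ S, ∀ l ∈ S, k ≠ l →
      Tendsto (fun m => f l m / f k m) atTop (𝓝 0) ∨
      Tendsto (fun m => f k m / f l m) atTop (𝓝 0))
    (w : K → ℝ) (hw : ∀ m, ∑ k ∈ S, w k * f k m = 0) : ∀ k ∈ S, w k = 0 := by
  classical
  by_contra! hne
  obtain ⟨k₀, hk₀, hwk₀⟩ := hne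
  -- Take the dominant function among those with nonzero weight; dividing the relation by it and
  -- passing to the limit leaves its weight alone, a contradiction.
  obtain ⟨k, hk, hdom⟩ := exists_dominant f hf (S.filter fun k => w k ≠ 0)
    ⟨k₀, Finset.mem_filter.2 ⟨hk₀, hwk₀⟩⟩ fun k hk l hl =>
      h k (Finset.mem_filter.1 hk).1 l (Finset.mem_filter.1 hl).1
  have hlim : Tendsto (fun m => ∑ l ∈ S, w l * (f l m / f k m)) atTop
      (𝓝 (∑ l ∈ S, if l = k then w k else 0)) := by
    refine tendsto_finsetSum _ fun l hl => ?_
    split_ifs with hlk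
    · subst hlk
      simp [div_self (hf l _)]
    · by_cases hwl : w l = 0
      · simp [hwl]
      · simpa using (hdom l (Finset.mem_filter.2 ⟨hl, hwl⟩) hlk).const_mul (w l)
  have hzero : ∀ m, ∑ l ∈ S, w l * (f l m / f k m) = 0 := fun m => by
    simp only [← mul_div_assoc, ← Finset.sum_div, hw m, zero_div]
  simp only [hzero, Finset.sum_ite_eq', (Finset.mem_filter.1 hk).1, if_true] at hlim
  exact (Finset.mem_filter.1 hk).2 (tendsto_nhds_unique tendsto_const_nhds hlim).symm

lemma linearIndependent_density (c d : ℕ) : LinearIndependent ℝ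
    fun (a : Component c d) (p : (Fin c → ℝ) × (Fin d → ℕ)) => a.density p.1 p.2 := by
  refine linearIndependent_iff'.2 fun S w hw => ?_
  obtain ⟨v, hv⟩ := Component.exists_densityAlong_comparable S
  refine eq_zero_of_sum_mul_eq_zero (fun a m => a.densityAlong v m) (fun a m => ?_) S hv w
    fun m => ?_
  · obtain ⟨_, _, _, h⟩ := a.densityAlong_bounds v
    obtain ⟨_, _, h, _⟩ := h m
    exact h.ne'
  · simpa [Component.densityAlong] using congrFun hw
      (fun j => speed m * v (Sum.inl j), fun j => v (Sum.inr j) ^ 2 * m + 1)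

/-- By injectivity no weights merge, and positive weights do not vanish; so each range is the
support of the common finitely supported function, whose values are the weights. -/
lemma exists_equiv_of_sum_single_eq {K : Type*} {m n : ℕ} {x : Fin m → K} {y : Fin n → K}
    (hx : Function.Injective x) (hy : Function.Injective y) {w : Fin m → ℝ} {w' : Fin n → ℝ}
    (hw : ∀ k, 0 < w k) (hw' : ∀ k, 0 < w' k)
    (h : ∑ k, Finsupp.single (x k) (w k) = ∑ k, Finsupp.single (y k) (w' k)) :
    ∃ τ : Fin m ≃ Fin n, ∀ k, w' (τ k) = w k ∧ y (τ k) = x k := by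
  classical
  have hval : ∀ {n : ℕ} {x : Fin n → K} (_ : Function.Injective x) (w : Fin n → ℝ) (k : Fin n),
      (∑ k, Finsupp.single (x k) (w k)) (x k) = w k := fun hx w k => by
    simp [Finsupp.finsetSum_apply, Finsupp.single_apply, hx.eq_iff]
  have hmem : ∀ {n : ℕ} {x : Fin n → K} (w : Fin n → ℝ) (b : K),
      (∑ k, Finsupp.single (x k) (w k)) b ≠ 0 → b ∈ Set.range x := fun {n x} w b hb => by
    by_contra hne
    refine hb ?_
    rw [Finsupp.finsetSum_apply]
    exact Finset.sum_eq_zero fun k _ => Finsupp.single_eq_of_ne fun hk => hne ⟨k, hk.symm⟩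
  have hrange : Set.range x = Set.range y := by
    refine Set.Subset.antisymm ?_ ?_
    · rintro _ ⟨k, rfl⟩
      refine hmem w' _ ?_
      rw [← h, hval hx]
      exact (hw k).ne'
    · rintro _ ⟨k, rfl⟩
      refine hmem w _ ?_
      rw [h, hval hy]
      exact (hw' k).ne'
  refine ⟨((Equiv.ofInjective x hx).trans (Equiv.setCongr hrange)).trans
    (Equiv.ofInjective y hy).symm, fun k => ?_⟩
  set τ := ((Equiv.ofInjective x hx).trans (Equiv.setCongr hrange)).trans
    (Equiv.ofInjective y hy).symm with hτ
  have hk : y (τ k) = x k := by simp [hτ, Equiv.apply_ofInjective_symm]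
  refine ⟨?_, hk⟩
  rw [← hval hy w' (τ k), ← h, hk, hval hx]

end CopulaMixture

theorem mainTheorem1 (c d g g' : ℕ)
    (π : Fin g → ℝ) (hπ : ∀ k, 0 < π k) (hπ_sum : ∑ k, π k = 1)
    (α : Fin g → CopulaMixture.Component c d) (hα : Function.Injective α)
    (π' : Fin g' → ℝ) (hπ' : ∀ k, 0 < π' k) (hπ'_sum : ∑ k, π' k = 1)
    (α' : Fin g' → CopulaMixture.Component c d) (hα' : Function.Injective α')
    (h : ∀ (x : Fin c → ℝ) (n : Fin d → ℕ),
      ∑ k, π k * (α k).density x n = ∑ k, π' k * (α' k).density x n) :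
    g = g' ∧ ∃ τ : Fin g ≃ Fin g', ∀ k,
      π' (τ k) = π k ∧
      (α' (τ k)).mean = (α k).mean ∧
      (α' (τ k)).sd = (α k).sd ∧
      (α' (τ k)).rate = (α k).rate ∧
      (α' (τ k)).corr = (α k).corr := by
  have hsum : ∑ k, Finsupp.single (α k) (π k) = ∑ k, Finsupp.single (α' k) (π' k) := by
    -- Linear independence is injectivity of the linear combination map on finitely supported
    -- coefficients.
    refine CopulaMixture.linearIndependent_density c d ?_
    funext p
    simpa using h p.1 p.2
  obtain ⟨τ, hτ⟩ := CopulaMixture.exists_equiv_of_sum_single_eq hα hα' hπ hπ' hsum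
  refine ⟨Fin.equiv_iff_eq.1 ⟨τ⟩, τ, fun k => ?_⟩
  obtain ⟨h1, h2⟩ := hτ k
  exact ⟨h1, by rw [h2], by rw [h2], by rw [h2], by rw [h2]⟩
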